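/- Let $R$ be a commutative ring with $1$. A Lie superalgebra over $R$ is an $R$-module $L=L_0\oplus L_1$ with a bilinear product $[\,,]$ such that $[L_i,L_j]\subseteq L_{i+j}$ (indices in $\mathbb{Z}/2$), such that $$[b,a]=-(-1)^{|a||b|}[a,b],\qquad (-1)^{|a||c|}[a,[b,c]]+(-1)^{|b||a|}[b,[c,a]]+(-1)^{|c||b|}[c,[a,b]]=0$$ for all homogeneous $a,b,c$ (where $|x|=i$ for $x\in L_i$), such that $[a,a]=0$ for all $a\in L_0$ (the even elements), and such that $[[a,a],a]=0$ for all $a\in L_1$ (the odd elements). Let $(A,<)$ be a totally ordered set whose elements are each assigned a parity, even or odd. A complete set of basic commutators on $A$ is a totally ordered set $(C,<)$ of formal bracketed products of elements of $A$, built up by weight (the number of factors) as follows. The basic commutators of weight $1$ are the elements of $A$, in their given order. For $k\ge 2$, the basic commutators of weight $k$ are the products $[c,d]$ where $c,d$ are basic commutators whose weights add up to $k$, where $c>d$, and where $f\le d$ if $c$ has weight at least $2$ and $c=[e,f]$; they are ordered arbitrarily (but totally) among themselves, and they follow all basic commutators of smaller weight. Theorem. Let $L$ be a free Lie superalgebra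 over $R$, freely generated by $A$ (each element of $A$ being homogeneous of the assigned parity), and let $(C,<)$ be any complete set of basic commutators on $A$, evaluated in $L$. Then $L$ is a free $R$-module with basis $$C\cup\{[c,c] : c\in C \text{ odd}\}.$$ -/

import Mathlib

universe u v w

/-- The sign `(-1)^(i j)` attached to two parities `i, j ∈ ℤ/2`. -/
def superSign (R : Type u) [CommRing R] (i j : ZMod 2) : R := (-1) ^ (i.val * j.val)

/-- A Lie superalgebra `L = L₀ ⊕ L₁` over the commutative ring `R`; `grade i` is `Lᵢ`.
The elements of `grade 0` are even, those of `grade 1` are odd. No invertibility of `2` or `3` is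
assumed, and `[a,a] = 0` for even `a`, `[[a,a],a] = 0` for odd `a` are part of the definition. -/
class LieSuperalgebra (R : Type u) (L : Type w) [CommRing R] [AddCommGroup L] [Module R L] where
  /-- The homogeneous components `L₀`, `L₁`. -/
  grade : ZMod 2 → Submodule R L
  /-- `L` is the internal direct sum of `L₀` and `L₁`. -/
  isCompl_grade : IsCompl (grade 0) (grade 1)
  /-- The bilinear product `[x, y]`. -/
  bracket : L →ₗ[R] L →ₗ[R] L
  bracket_mem : ∀ (i j : ZMod 2) (x y : L), x ∈ grade i → y ∈ grade j →
    bracket x y ∈ grade (i + j)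
  bracket_swap : ∀ (i j : ZMod 2) (a b : L), a ∈ grade i → b ∈ grade j →
    bracket b a = -(superSign R i j • bracket a b)
  jacobi : ∀ (i j k : ZMod 2) (a b c : L), a ∈ grade i → b ∈ grade j → c ∈ grade k →
    superSign R i k • bracket a (bracket b c) + superSign R j i • bracket b (bracket c a)
      + superSign R k j • bracket c (bracket a b) = 0
  bracket_self_of_even : ∀ a : L, a ∈ grade 0 → bracket a a = 0
  bracket_bracket_self_of_odd : ∀ a : L, a ∈ grade 1 → bracket (bracket a a) a = 0

namespace LieSuperalgebra

/-- Homomorphisms of Lie superalgebras: linear maps that preserve the parity and the product. -/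
structure IsHom {R : Type*} {L M : Type*} [CommRing R]
    [AddCommGroup L] [Module R L] [LieSuperalgebra R L]
    [AddCommGroup M] [Module R M] [LieSuperalgebra R M] (φ : L →ₗ[R] M) : Prop where
  map_grade : ∀ (i : ZMod 2) (x : L), x ∈ grade (R := R) (L := L) i →
    φ x ∈ grade (R := R) (L := M) i
  map_bracket : ∀ x y : L, φ (bracket (R := R) x y) = bracket (R := R) (φ x) (φ y)

/-- `L` is freely generated, as a Lie superalgebra over `R`, by the homogeneous elements `ι a`,
`a : A`, where `ι a` has parity `p a`: every parity-respecting map from `A` to a Lie superalgebra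
`M` extends uniquely to a homomorphism `L → M`. The universe of `M` is large enough to contain
copies of `R`, `A` and `L`, and of everything that is built from them. -/
structure IsFreeOn (R : Type u) [CommRing R] {A : Type v} (p : A → ZMod 2) {L : Type w}
    [AddCommGroup L] [Module R L] [LieSuperalgebra R L] (ι : A → L) : Prop where
  mem_grade : ∀ a : A, ι a ∈ grade (R := R) (L := L) (p a)
  existsUnique_lift : ∀ (M : Type (max u v w)) [AddCommGroup M] [Module R M]
    [LieSuperalgebra R M] (f : A → M), (∀ a : A, f a ∈ grade (R := R) (L := M) (p a)) →
    ∃! φ : L →ₗ[R] M, IsHom φ ∧ ∀ a : A, φ (ι a) = f a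

/-- The element of `L` given by a formal bracketed product of generators. -/
def eval (R : Type*) [CommRing R] {A : Type*} {L : Type*}
    [AddCommGroup L] [Module R L] [LieSuperalgebra R L] (ι : A → L) : FreeMagma A → L
  | FreeMagma.of a => ι a
  | FreeMagma.mul c d => bracket (R := R) (eval R ι c) (eval R ι d)

end LieSuperalgebra

/-- The basic commutators on `A` with respect to a relation `lt` (`lt d c` means `d < c`), as formal
bracketed products; `c * d` stands for `[c, d]`. The generators are basic, and `[c, d]` is basic if
`c` and `d` are, `c > d`, and `f ≤ d` in case `c` is itself a product `[e, f]`. -/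
inductive IsBasicCommutator {A : Type*} (lt : FreeMagma A → FreeMagma A → Prop) :
    FreeMagma A → Prop
  | of (a : A) : IsBasicCommutator lt (FreeMagma.of a)
  | mul (c d : FreeMagma A) : IsBasicCommutator lt c → IsBasicCommutator lt d → lt d c →
      (∀ e f : FreeMagma A, c = e * f → f = d ∨ lt f d) → IsBasicCommutator lt (c * d)

/-- `lt` is an admissible ordering of its basic commutators: a strict total order on them that
extends the order of the generators and in which basic commutators of smaller weight come first.
Within one weight (at least two) the order is arbitrary. The weight is `FreeMagma.length`. The set
of all basic commutators with respect to such an `lt`, ordered by `lt`, is a complete set of basic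
commutators on `A`. Nothing is required of `lt` outside this set. -/
structure IsBasicOrder {A : Type*} [LinearOrder A] (lt : FreeMagma A → FreeMagma A → Prop) :
    Prop where
  irrefl : ∀ c, IsBasicCommutator lt c → ¬ lt c c
  trans : ∀ c d e, IsBasicCommutator lt c → IsBasicCommutator lt d → IsBasicCommutator lt e →
    lt c d → lt d e → lt c e
  total : ∀ c d, IsBasicCommutator lt c → IsBasicCommutator lt d → lt c d ∨ c = d ∨ lt d c
  of_lt_of : ∀ a b : A, lt (FreeMagma.of a) (FreeMagma.of b) ↔ a < b
  lt_of_length_lt : ∀ c d, IsBasicCommutator lt c → IsBasicCommutator lt d →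
    c.length < d.length → lt c d

/-!
The proof is Lazard elimination, carried out twice. Fix a finite set of letters and take the basic
commutators in them one at a time, in increasing order. After an initial segment `D` has been
eliminated, the remaining alphabet consists of the basic commutators outside `D` that are letters or
products `[e, f]` with `f ∈ D` (`eliminationAlphabet`). Its least element is the next basic
commutator `m`, and eliminating `m` replaces the other elements `c` of the alphabet by
`c, [c, m], [[c, m], m], …`.

In any Lie superalgebra, the subalgebra generated by an alphabet is spanned by `m`, `[m, m]` and the
subalgebra generated by the next alphabet, since the latter is stable under bracketing with `m`
(`eval_mem_span_elimSpanning`). Once all basic commutators of weight at most `n` have been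
eliminated, nothing of weight `n` is left. So the basic commutators `c` and the squares `[c, c]` of
the odd ones span (`eval_mem_basicSpan`).

In the free associative algebra, each alphabet generates a free subalgebra, and `m`, `m ^ 2` are
independent modulo the subalgebra generated by the next alphabet (`superEvalLift_insert`). This is
seen on the free module on the monomials `w z ^ j`, with `w` a word in the next alphabet: each letter
acts as left multiplication, `m` acting as `z`, which is moved to the right by the commutation rule.
So the `c` and the `c ^ 2` are linearly independent (`superEval_independent`).

For odd `c` the supercommutator `[c, c]` is `2 c ^ 2`, which vanishes in characteristic two; so the
free associative algebra is used over `ℤ` only. There the Lie superalgebra generated by the letters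
has the expected basis by the two arguments above. Its base change to `R` is a Lie superalgebra to
which the free one maps, and the images of the expected basis elements are linearly independent
(`exists_linearIndependent_basicFamily`).
-/

/-! ### Signs and identities in a Lie superalgebra -/

theorem ZMod.eq_zero_or_eq_one_of_two (i : ZMod 2) : i = 0 ∨ i = 1 := by
  revert i; decide

section superSign

variable (R : Type*) [CommRing R]

@[simp] theorem superSign_zero_left (j : ZMod 2) : superSign R 0 j = 1 := by simp [superSign]

@[simp] theorem superSign_zero_right (i : ZMod 2) : superSign R i 0 = 1 := by simp [superSign]

@[simp] theorem superSign_one_one : superSign R 1 1 = -1 := by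
  simp [superSign, show (1 : ZMod 2).val = 1 from rfl]

theorem superSign_mul_self (i j : ZMod 2) : superSign R i j * superSign R i j = 1 := by
  rcases i.eq_zero_or_eq_one_of_two with rfl | rfl <;>
    rcases j.eq_zero_or_eq_one_of_two with rfl | rfl <;> simp

theorem superSign_comm (i j : ZMod 2) : superSign R i j = superSign R j i := by
  simp [superSign, mul_comm]

end superSign

namespace LieSuperalgebra

variable {R L : Type*} [CommRing R] [AddCommGroup L] [Module R L] [LieSuperalgebra R L]

/-- The bracket with a fixed homogeneous element on the right is a superderivation. -/
theorem bracket_bracket_left {i j k : ZMod 2} {a b c : L} (ha : a ∈ grade (R := R) i)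
    (hb : b ∈ grade (R := R) j) (hc : c ∈ grade (R := R) k) :
    bracket (R := R) (bracket (R := R) a b) c = bracket (R := R) a (bracket (R := R) b c) +
      superSign R j k • bracket (R := R) (bracket (R := R) a c) b := by
  have h := jacobi i j k a b c ha hb hc
  rw [bracket_swap i k a c ha hc, bracket_swap _ k _ c (bracket_mem i j a b ha hb) hc, map_neg,
    map_smul, bracket_swap _ j _ b (bracket_mem i k a c ha hc) hb] at h
  rcases i.eq_zero_or_eq_one_of_two with rfl | rfl <;>
    rcases j.eq_zero_or_eq_one_of_two with rfl | rfl <;>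
    rcases k.eq_zero_or_eq_one_of_two with rfl | rfl <;>
    simp [show (1 : ZMod 2) + 1 = 0 from rfl] at h ⊢ <;>
    first
    | (rw [← sub_eq_zero, ← h]; abel1)
    | (rw [← sub_eq_zero, ← neg_eq_zero, ← h]; abel1)

/-- Bracketing with `[c, c]`, for odd `c`, is twice the square of bracketing with `c`. -/
theorem bracket_bracket_self {j : ZMod 2} {a c : L} (ha : a ∈ grade (R := R) j)
    (hc : c ∈ grade (R := R) 1) : bracket (R := R) a (bracket (R := R) c c) =
      (2 : R) • bracket (R := R) (bracket (R := R) a c) c := by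
  have h := bracket_bracket_left ha hc hc
  simp at h
  rw [two_smul, ← sub_eq_zero]
  rw [← sub_eq_zero] at h
  rw [← neg_eq_zero, ← h]
  abel

end LieSuperalgebra

/-! ### Values of formal products, subalgebras and generation -/

/-- The parity of a formal bracketed product: the sum of the parities of its factors. -/
def FreeMagma.parity {A : Type*} (p : A → ZMod 2) : FreeMagma A → ZMod 2
  | FreeMagma.of a => p a
  | FreeMagma.mul c d => FreeMagma.parity p c + FreeMagma.parity p d

namespace LieSuperalgebra

section eval

variable {R L A : Type*} [CommRing R] [AddCommGroup L] [Module R L] [LieSuperalgebra R L]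

theorem eval_mul (ι : A → L) (c d : FreeMagma A) :
    eval R ι (c * d) = bracket (R := R) (eval R ι c) (eval R ι d) := rfl

theorem eval_mem_grade {p : A → ZMod 2} {ι : A → L}
    (hι : ∀ a, ι a ∈ grade (R := R) (L := L) (p a)) (c : FreeMagma A) :
    eval R ι c ∈ grade (R := R) (L := L) (c.parity p) := by
  induction c with
  | ih1 a => exact hι a
  | ih2 c d hc hd => exact bracket_mem _ _ _ _ hc hd

theorem IsHom.map_eval {M : Type*} [AddCommGroup M] [Module R M] [LieSuperalgebra R M]
    {φ : L →ₗ[R] M} (hφ : IsHom φ) (ι : A → L) (c : FreeMagma A) :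
    φ (eval R ι c) = eval R (fun a => φ (ι a)) c := by
  induction c with
  | ih1 a => rfl
  | ih2 c d hc hd => rw [eval_mul, eval_mul, hφ.map_bracket, hc, hd]

end eval

section ofInjective

variable {R L N : Type*} [CommRing R] [AddCommGroup L] [Module R L] [LieSuperalgebra R L]
  [AddCommGroup N] [Module R N]

/-- The Lie superalgebra structure that a module `N` inherits from `L` along an injective linear
map whose range is closed under the bracket and spanned by its homogeneous elements. -/
@[reducible] def ofInjective (j : N →ₗ[R] L) (hj : Function.Injective j)
    (br : N → N → N) (hbr : ∀ x y, j (br x y) = bracket (R := R) (j x) (j y))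
    (hgr : ∀ x, ∃ y z, j y ∈ grade (R := R) (L := L) 0 ∧ j z ∈ grade (R := R) (L := L) 1 ∧
      x = y + z) : LieSuperalgebra R N where
  grade i := (grade i).comap j
  isCompl_grade := by
    constructor
    · rw [Submodule.disjoint_def]
      intro x h0 h1
      exact hj (by
        simpa using Submodule.disjoint_def.1 (isCompl_grade (R := R) (L := L)).disjoint _ h0 h1)
    · rw [codisjoint_iff, eq_top_iff]
      intro x _
      obtain ⟨y, z, hy, hz, rfl⟩ := hgr x
      exact Submodule.add_mem_sup hy hz
  bracket := LinearMap.mk₂ R br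
    (fun x y z => hj (by simp [hbr]))
    (fun r x y => hj (by simp [hbr]))
    (fun x y z => hj (by simp [hbr]))
    (fun r x y => hj (by simp [hbr]))
  bracket_mem k l x y hx hy := by
    simpa [hbr] using bracket_mem k l _ _ hx hy
  bracket_swap k l x y hx hy := hj (by
    simpa [hbr] using bracket_swap k l _ _ hx hy)
  jacobi k l m x y z hx hy hz := hj (by
    simpa [hbr] using jacobi k l m _ _ _ hx hy hz)
  bracket_self_of_even x hx := hj (by
    simpa [hbr] using bracket_self_of_even _ hx)
  bracket_bracket_self_of_odd x hx := hj (by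
    simpa [hbr] using bracket_bracket_self_of_odd _ hx)

theorem isHom_ofInjective (j : N →ₗ[R] L) (hj : Function.Injective j)
    (br : N → N → N) (hbr : ∀ x y, j (br x y) = bracket (R := R) (j x) (j y))
    (hgr : ∀ x, ∃ y z, j y ∈ grade (R := R) (L := L) 0 ∧ j z ∈ grade (R := R) (L := L) 1 ∧
      x = y + z) :
    letI := ofInjective j hj br hbr hgr
    IsHom j :=
  letI := ofInjective j hj br hbr hgr
  { map_grade := fun _ _ hx => hx
    map_bracket := fun x y => hbr x y }

end ofInjective

section span

variable {R L A : Type*} [CommRing R] [AddCommGroup L] [Module R L] [LieSuperalgebra R L]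

theorem bracket_mem_span_eval (ι : A → L) {x y : L}
    (hx : x ∈ Submodule.span R (Set.range (eval R ι)))
    (hy : y ∈ Submodule.span R (Set.range (eval R ι))) :
    bracket (R := R) x y ∈ Submodule.span R (Set.range (eval R ι)) := by
  induction hx, hy using Submodule.span_induction₂ with
  | mem_mem x y hx hy =>
    obtain ⟨c, rfl⟩ := hx
    obtain ⟨d, rfl⟩ := hy
    exact Submodule.subset_span ⟨c * d, rfl⟩
  | zero_left y hy => simp
  | zero_right x hx => simp
  | add_left x y z _ _ _ h h' => simpa using add_mem h h'
  | add_right x y z _ _ _ h h' => simpa using add_mem h h'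
  | smul_left r x y _ _ h => simpa using Submodule.smul_mem _ r h
  | smul_right r x y _ _ h => simpa using Submodule.smul_mem _ r h

theorem exists_homogeneous_of_mem_span_eval {p : A → ZMod 2} {ι : A → L}
    (hι : ∀ a, ι a ∈ grade (R := R) (L := L) (p a)) {x : L}
    (hx : x ∈ Submodule.span R (Set.range (eval R ι))) :
    ∃ y ∈ Submodule.span R (Set.range (eval R ι)), ∃ z ∈ Submodule.span R (Set.range (eval R ι)),
      y ∈ grade (R := R) (L := L) 0 ∧ z ∈ grade (R := R) (L := L) 1 ∧ x = y + z := by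
  induction hx using Submodule.span_induction with
  | mem x hx =>
    obtain ⟨c, rfl⟩ := hx
    have hc := Submodule.subset_span (R := R) (Set.mem_range_self (f := eval R ι) c)
    have hg := eval_mem_grade (R := R) hι c
    rcases (c.parity p).eq_zero_or_eq_one_of_two with h | h <;> rw [h] at hg
    · exact ⟨_, hc, 0, zero_mem _, hg, zero_mem _, by simp⟩
    · exact ⟨0, zero_mem _, _, hc, zero_mem _, hg, by simp⟩
  | zero => exact ⟨0, zero_mem _, 0, zero_mem _, zero_mem _, zero_mem _, by simp⟩
  | add x y _ _ h h' =>
    obtain ⟨a, ha, b, hb, ha', hb', rfl⟩ := h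
    obtain ⟨c, hc, d, hd, hc', hd', rfl⟩ := h'
    exact ⟨a + c, add_mem ha hc, b + d, add_mem hb hd, add_mem ha' hc', add_mem hb' hd', by abel⟩
  | smul r x _ h =>
    obtain ⟨a, ha, b, hb, ha', hb', rfl⟩ := h
    exact ⟨r • a, Submodule.smul_mem _ _ ha, r • b, Submodule.smul_mem _ _ hb,
      Submodule.smul_mem _ _ ha', Submodule.smul_mem _ _ hb', by simp⟩

end span

/-- A free Lie superalgebra is spanned by the products of its generators: lift the generators to the
subalgebra that these span; by uniqueness of lifts, its inclusion is onto. -/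
theorem IsFreeOn.span_eval_eq_top {R : Type u} [CommRing R] {A : Type v} {p : A → ZMod 2}
    {L : Type w} [AddCommGroup L] [Module R L] [LieSuperalgebra R L] {ι : A → L}
    (hι : IsFreeOn R p ι) : Submodule.span R (Set.range (eval R ι)) = ⊤ := by
  set K := Submodule.span R (Set.range (eval R ι)) with hK
  -- Lifts are only available into the larger universe, whence the two copies by `ULift`.
  let jK : ULift.{max u v} K →ₗ[R] L := K.subtype ∘ₗ ULift.moduleEquiv.toLinearMap
  let jL : ULift.{max u v} L →ₗ[R] L := ULift.moduleEquiv.toLinearMap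
  have hjK : Function.Injective jK := K.injective_subtype.comp ULift.moduleEquiv.injective
  have hjL : Function.Injective jL := ULift.moduleEquiv.injective
  have gK : ∀ x, ∃ y z, jK y ∈ grade (R := R) (L := L) 0 ∧ jK z ∈ grade (R := R) (L := L) 1 ∧
      x = y + z := fun x => by
    obtain ⟨y, hy, z, hz, hy', hz', h⟩ :=
      exists_homogeneous_of_mem_span_eval hι.mem_grade x.down.2
    exact ⟨⟨⟨y, hy⟩⟩, ⟨⟨z, hz⟩⟩, hy', hz', hjK h⟩
  have gL : ∀ x, ∃ y z, jL y ∈ grade (R := R) (L := L) 0 ∧ jL z ∈ grade (R := R) (L := L) 1 ∧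
      x = y + z := fun x => by
    have h : x.down ∈ grade (R := R) (L := L) 0 ⊔ grade (R := R) (L := L) 1 := by
      rw [isCompl_grade.sup_eq_top]; trivial
    obtain ⟨y, hy, z, hz, h⟩ := Submodule.mem_sup.1 h
    exact ⟨⟨y⟩, ⟨z⟩, hy, hz, hjL h.symm⟩
  let iK := ofInjective jK hjK
    (fun x y => ⟨⟨_, bracket_mem_span_eval ι x.down.2 y.down.2⟩⟩) (fun _ _ => rfl) gK
  let iL := ofInjective jL hjL (fun x y => ⟨bracket (R := R) x.down y.down⟩) (fun _ _ => rfl) gL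
  have hK' : IsHom jK := isHom_ofInjective jK hjK _ (fun _ _ => rfl) gK
  have hL' : IsHom jL := isHom_ofInjective jL hjL _ (fun _ _ => rfl) gL
  obtain ⟨f, ⟨hf, hfa⟩, -⟩ := hι.existsUnique_lift (ULift.{max u v} K)
    (fun a => ⟨⟨ι a, Submodule.subset_span ⟨FreeMagma.of a, rfl⟩⟩⟩) (fun a => hι.mem_grade a)
  obtain ⟨g, -, hg⟩ := hι.existsUnique_lift (ULift.{max u v} L) (fun a => ⟨ι a⟩)
    (fun a => hι.mem_grade a)
  let up : L →ₗ[R] ULift.{max u v} L := ULift.moduleEquiv.symm.toLinearMap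
  have h1 : up = g := hg _ ⟨⟨fun i x hx => hx, fun x y => hjL (hL'.map_bracket _ _).symm⟩,
    fun a => rfl⟩
  have h2 : up ∘ₗ jK ∘ₗ f = g := hg _ ⟨⟨fun i x hx => hf.map_grade _ _ hx, fun x y => hjL (by
    rw [hL'.map_bracket]
    change jK (f _) = bracket (R := R) (jK (f x)) (jK (f y))
    rw [hf.map_bracket, hK'.map_bracket])⟩, fun a => by simp [hfa]; rfl⟩
  rw [eq_top_iff]
  intro x _
  have h3 : jK (f x) = x := congrArg ULift.down (LinearMap.congr_fun (h2.trans h1.symm) x)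
  rw [← h3]
  exact (f x).down.2

end LieSuperalgebra

/-! ### Initial segments of the basic commutators and their elimination alphabets -/

theorem FreeMagma.mul_inj {A : Type*} {c d e f : FreeMagma A} : c * d = e * f ↔ c = e ∧ d = f :=
  ⟨fun h => by injection h with h1 h2; exact ⟨h1, h2⟩, fun h => by rw [h.1, h.2]⟩

@[simp] theorem FreeMagma.length_mul {A : Type*} (c d : FreeMagma A) :
    (c * d).length = c.length + d.length := rfl

/-- All the letters of a formal product belong to `F`. -/
def FreeMagma.SupportedIn {A : Type*} (F : Set A) : FreeMagma A → Prop
  | FreeMagma.of a => a ∈ F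
  | FreeMagma.mul c d => FreeMagma.SupportedIn F c ∧ FreeMagma.SupportedIn F d

theorem FreeMagma.SupportedIn.mono {A : Type*} {F G : Set A} (h : F ⊆ G) {c : FreeMagma A}
    (hc : c.SupportedIn F) : c.SupportedIn G := by
  induction c with
  | ih1 a => exact h hc
  | ih2 c d ihc ihd => exact ⟨ihc hc.1, ihd hc.2⟩

theorem FreeMagma.exists_finite_supportedIn {A : Type*} (c : FreeMagma A) :
    ∃ F : Set A, F.Finite ∧ c.SupportedIn F := by
  induction c with
  | ih1 a => exact ⟨{a}, Set.finite_singleton a, rfl⟩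
  | ih2 c d hc hd =>
    obtain ⟨F, hF, hc⟩ := hc
    obtain ⟨G, hG, hd⟩ := hd
    exact ⟨F ∪ G, hF.union hG, hc.mono Set.subset_union_left, hd.mono Set.subset_union_right⟩

theorem FreeMagma.finite_supportedIn_length_le {A : Type*} {F : Set A} (hF : F.Finite) (n : ℕ) :
    {c : FreeMagma A | c.SupportedIn F ∧ c.length ≤ n}.Finite := by
  induction n with
  | zero =>
    convert Set.finite_empty
    ext c
    simpa using fun _ => c.length_pos.ne'
  | succ n ih =>
    refine ((hF.image FreeMagma.of).union (Set.Finite.image2 (· * ·) ih ih)).subset ?_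
    rintro (a | ⟨c, d⟩) ⟨hc, hn⟩
    · exact Or.inl ⟨a, hc, rfl⟩
    · have h : c.length + d.length ≤ n + 1 := hn
      have := c.length_pos
      have := d.length_pos
      exact Or.inr ⟨c, ⟨hc.1, by lia⟩, d, ⟨hc.2, by lia⟩, rfl⟩

/-- The formal products that are iterated products of elements of `S`. -/
inductive FreeMagma.GeneratedBy {A : Type*} (S : Set (FreeMagma A)) : FreeMagma A → Prop
  | base (c : FreeMagma A) : c ∈ S → GeneratedBy S c
  | mul (c d : FreeMagma A) : GeneratedBy S c → GeneratedBy S d → GeneratedBy S (c * d)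

theorem FreeMagma.GeneratedBy.mono {A : Type*} {S T : Set (FreeMagma A)} (h : S ⊆ T) {t : FreeMagma A}
    (ht : FreeMagma.GeneratedBy S t) : FreeMagma.GeneratedBy T t := by
  induction ht with
  | base c hc => exact .base c (h hc)
  | mul c d _ _ hc hd => exact .mul c d hc hd

theorem Set.Finite.exists_greatest_of_total {α : Type*} {r : α → α → Prop} {s : Set α}
    (hs : s.Finite) (hne : s.Nonempty)
    (htrans : ∀ a ∈ s, ∀ b ∈ s, ∀ c ∈ s, r a b → r b c → r a c)
    (htotal : ∀ a ∈ s, ∀ b ∈ s, r a b ∨ a = b ∨ r b a) :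
    ∃ m ∈ s, ∀ d ∈ s, d = m ∨ r d m := by
  suffices h : ∀ t : Set α, t.Finite → t ⊆ s → t.Nonempty → ∃ m ∈ t, ∀ d ∈ t, d = m ∨ r d m from
    h s hs subset_rfl hne
  intro t ht
  induction t, ht using Set.Finite.induction_on with
  | empty => exact fun _ h => absurd h Set.not_nonempty_empty
  | @insert a t _ _ ih =>
    intro hts _
    rcases t.eq_empty_or_nonempty with rfl | hne
    · exact ⟨a, by simp, fun d hd => Or.inl (by simpa using hd)⟩
    obtain ⟨m, hm, h⟩ := ih (fun x hx => hts (Or.inr hx)) hne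
    have ha := hts (Set.mem_insert a t)
    have hms := hts (Or.inr hm)
    rcases htotal a ha m hms with h1 | rfl | h1
    · exact ⟨m, Or.inr hm, fun d hd => hd.elim (fun e => Or.inr (e ▸ h1)) (h d)⟩
    · exact ⟨a, Or.inl rfl, fun d hd => hd.elim Or.inl (h d)⟩
    · refine ⟨a, Or.inl rfl, fun d hd => hd.elim Or.inl fun hd => Or.inr ?_⟩
      rcases h d hd with rfl | h2
      · exact h1
      · exact htrans d (hts (Or.inr hd)) m hms a ha h2 h1

section Hall

variable {A : Type*}

/-- The basic commutators all of whose letters belong to `F`. -/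
def basicIn (lt : FreeMagma A → FreeMagma A → Prop) (F : Set A) : Set (FreeMagma A) :=
  {c | IsBasicCommutator lt c ∧ c.SupportedIn F}

/-- `D` is an initial segment of the basic commutators with letters in `F`. -/
structure IsInitialIn (lt : FreeMagma A → FreeMagma A → Prop) (F : Set A)
    (D : Set (FreeMagma A)) : Prop where
  subset : D ⊆ basicIn lt F
  mem_of_lt : ∀ c ∈ D, ∀ d ∈ basicIn lt F, lt d c → d ∈ D

/-- The alphabet that is left when the members of the initial segment `D` have been eliminated:
the basic commutators outside `D` that are letters in `F` or products `[e, f]` with `f` in `D`.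
The basic commutators outside `D` are products of its elements. -/
def eliminationAlphabet (lt : FreeMagma A → FreeMagma A → Prop) (F : Set A)
    (D : Set (FreeMagma A)) : Set (FreeMagma A) :=
  {c | c ∈ basicIn lt F ∧ c ∉ D ∧ ∀ e f, c = e * f → f ∈ D}

theorem IsBasicCommutator.mul_iff {lt : FreeMagma A → FreeMagma A → Prop} {c d : FreeMagma A} :
    IsBasicCommutator lt (c * d) ↔ IsBasicCommutator lt c ∧ IsBasicCommutator lt d ∧ lt d c ∧
      ∀ e f : FreeMagma A, c = e * f → f = d ∨ lt f d := by
  constructor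
  · intro h
    generalize hx : c * d = x at h
    cases h with
    | of a => cases hx
    | mul c' d' h1 h2 h3 h4 =>
      obtain ⟨rfl, rfl⟩ := FreeMagma.mul_inj.1 hx
      exact ⟨h1, h2, h3, h4⟩
  · rintro ⟨h1, h2, h3, h4⟩
    exact .mul _ _ h1 h2 h3 h4

theorem of_mul_mem_basicIn {lt : FreeMagma A → FreeMagma A → Prop} {F : Set A} {c d : FreeMagma A}
    (h : c * d ∈ basicIn lt F) : c ∈ basicIn lt F ∧ d ∈ basicIn lt F ∧ lt d c ∧
      ∀ e f : FreeMagma A, c = e * f → f = d ∨ lt f d := by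
  obtain ⟨h1, h2, h3, h4⟩ := IsBasicCommutator.mul_iff.1 h.1
  exact ⟨⟨h1, h.2.1⟩, ⟨h2, h.2.2⟩, h3, h4⟩

variable {lt : FreeMagma A → FreeMagma A → Prop} {F : Set A}
  {D : Set (FreeMagma A)} {m : FreeMagma A}

namespace IsInitialIn

theorem mem_basicIn_of_insert (hD' : IsInitialIn lt F (insert m D)) : m ∈ basicIn lt F :=
  hD'.subset (Set.mem_insert m D)

theorem mem_eliminationAlphabet_insert {c : FreeMagma A} (hc : c ∈ eliminationAlphabet lt F D)
    (hcm : c ≠ m) : c ∈ eliminationAlphabet lt F (insert m D) :=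
  ⟨hc.1, by simp [hcm, hc.2.1], fun e f h => Or.inr (hc.2.2 e f h)⟩

theorem generatedBy_eliminationAlphabet (hD : IsInitialIn lt F D)
    {c : FreeMagma A} (hc : c ∈ basicIn lt F) (hcD : c ∉ D) :
    FreeMagma.GeneratedBy (eliminationAlphabet lt F D) c := by
  induction c with
  | ih1 a => exact .base _ ⟨hc, hcD, fun e f h => by cases h⟩
  | ih2 e f ihe ihf =>
    obtain ⟨he, hf, hfe, -⟩ := of_mul_mem_basicIn hc
    by_cases hfD : f ∈ D
    · refine .base _ ⟨hc, hcD, fun g k h => ?_⟩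
      rwa [← (FreeMagma.mul_inj.1 h).2]
    · exact .mul _ _ (ihe he fun h => hfD (hD.mem_of_lt e h f hf hfe)) (ihf hf hfD)

end IsInitialIn

variable [LinearOrder A]

/-- Every finite initial segment is reached from `∅` by adding one element at a time, always the
smallest one that is missing. -/
theorem IsInitialIn.induction (hlt : IsBasicOrder lt) {P : Set (FreeMagma A) → Prop}
    (empty : P ∅)
    (insert : ∀ D m, IsInitialIn lt F D → IsInitialIn lt F (insert m D) → m ∉ D → P D →
      P (insert m D)) (hfin : D.Finite) (hD : IsInitialIn lt F D) : P D := by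
  induction hn : D.ncard generalizing D with
  | zero => rwa [(Set.ncard_eq_zero hfin).1 hn]
  | succ n ih =>
    obtain ⟨m, hm, hmax⟩ := hfin.exists_greatest_of_total (r := lt)
      (Set.nonempty_of_ncard_ne_zero (by lia))
      (fun a ha b hb c hc => hlt.trans a b c (hD.subset ha).1 (hD.subset hb).1 (hD.subset hc).1)
      (fun a ha b hb => hlt.total a b (hD.subset ha).1 (hD.subset hb).1)
    have hE : IsInitialIn lt F (D \ {m}) := by
      refine ⟨fun c hc => hD.subset hc.1, fun c hc d hd h => ⟨hD.mem_of_lt c hc.1 d hd h, ?_⟩⟩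
      rintro rfl
      have hdc := (hmax c hc.1).resolve_left hc.2
      exact hlt.irrefl d hd.1 (hlt.trans d c d hd.1 (hD.subset hc.1).1 hd.1 h hdc)
    have hins : Insert.insert m (D \ {m}) = D := by simp [Set.insert_eq_of_mem hm]
    have := insert (D \ {m}) m hE (by rwa [hins]) (by simp)
      (ih (hfin.subset Set.sdiff_subset) hE (by rw [Set.ncard_sdiff_singleton_of_mem hm, hn]; rfl))
    rwa [hins] at this

namespace IsInitialIn

theorem lt_of_notMem (hlt : IsBasicOrder lt) (hD : IsInitialIn lt F D) {c d : FreeMagma A}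
    (hd : d ∈ D) (hc : c ∈ basicIn lt F) (hcD : c ∉ D) : lt d c := by
  rcases hlt.total d c (hD.subset hd).1 hc.1 with h | rfl | h
  · exact h
  · exact absurd hd hcD
  · exact absurd (hD.mem_of_lt d hd c hc h) hcD

theorem mem_of_lt_of_insert (hlt : IsBasicOrder lt) (hD' : IsInitialIn lt F (insert m D))
    {c : FreeMagma A} (hc : c ∈ basicIn lt F) (h : lt c m) : c ∈ D :=
  (hD'.mem_of_lt m (Set.mem_insert m D) c hc h).resolve_left
    (by rintro rfl; exact hlt.irrefl c hc.1 h)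

theorem mem_eliminationAlphabet (hlt : IsBasicOrder lt)
    (hD' : IsInitialIn lt F (insert m D)) (hm : m ∉ D) : m ∈ eliminationAlphabet lt F D := by
  refine ⟨hD'.mem_basicIn_of_insert, hm, ?_⟩
  rintro e f rfl
  obtain ⟨h1, h2, h3, -⟩ := of_mul_mem_basicIn hD'.mem_basicIn_of_insert
  refine hD'.mem_of_lt_of_insert hlt h2 (hlt.lt_of_length_lt _ _ h2.1
    hD'.mem_basicIn_of_insert.1 ?_)
  have := e.length_pos
  simpa

theorem mul_mem_eliminationAlphabet_insert (hlt : IsBasicOrder lt) (hD : IsInitialIn lt F D)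
    (hD' : IsInitialIn lt F (insert m D)) (hm : m ∉ D) {c : FreeMagma A}
    (hc : c ∈ eliminationAlphabet lt F (insert m D)) :
    c * m ∈ eliminationAlphabet lt F (insert m D) := by
  have hmF := hD'.mem_basicIn_of_insert
  have hcF : c * m ∈ basicIn lt F := by
    refine ⟨.mul c m hc.1.1 hmF.1 (hD'.lt_of_notMem hlt (Set.mem_insert m D) hc.1 hc.2.1) ?_,
      hc.1.2, hmF.2⟩
    intro e f h
    exact (hc.2.2 e f h).imp id fun hf => hD.lt_of_notMem hlt hf hmF hm
  refine ⟨hcF, ?_, fun e f h => (FreeMagma.mul_inj.1 h).2 ▸ Set.mem_insert _ _⟩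
  have hlen : m.length < (c * m).length := by
    have := c.length_pos
    simpa
  rintro (h | h)
  · rw [h] at hlen
    exact lt_irrefl _ hlen
  · exact hm (hD.mem_of_lt _ h m hmF (hlt.lt_of_length_lt _ _ hmF.1 hcF.1 hlen))

/-- The alphabet left after eliminating `m` consists of the elements `[…[[c, m], m]…, m]`, where `c`
belongs to the previous alphabet and differs from `m`. -/
theorem eliminationAlphabet_insert_cases (hlt : IsBasicOrder lt) (hD : IsInitialIn lt F D)
    (hD' : IsInitialIn lt F (insert m D)) {c : FreeMagma A}
    (hc : c ∈ eliminationAlphabet lt F (insert m D)) :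
    (c ∈ eliminationAlphabet lt F D ∧ c ≠ m) ∨
      ∃ e ∈ eliminationAlphabet lt F (insert m D), c = e * m := by
  have hmF := hD'.mem_basicIn_of_insert
  obtain ⟨h1, h2⟩ := not_or.1 hc.2.1
  by_cases h : ∀ e f, c = e * f → f ∈ D
  · exact Or.inl ⟨⟨hc.1, h2, h⟩, h1⟩
  · push Not at h
    obtain ⟨e, f, rfl, hf⟩ := h
    obtain rfl : f = m := (hc.2.2 e f rfl).resolve_right hf
    obtain ⟨he, -, hlt', hef⟩ := of_mul_mem_basicIn hc.1
    refine Or.inr ⟨e, ⟨he, ?_, fun g k hgk => ?_⟩, rfl⟩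
    · rintro (rfl | h)
      · exact hlt.irrefl _ he.1 hlt'
      · exact hf (hD.mem_of_lt _ h _ hmF hlt')
    · refine (hef g k hgk).imp id fun h => ?_
      subst hgk
      exact hD'.mem_of_lt_of_insert hlt (of_mul_mem_basicIn he).2.1 h

end IsInitialIn

end Hall

/-! ### Elimination in a Lie superalgebra: the basic commutators span -/

namespace LieSuperalgebra

variable {R L A : Type*} [CommRing R] [AddCommGroup L] [Module R L] [LieSuperalgebra R L]

theorem bracket_mem_of_mem_span {s t : Set L} {q : Submodule R L}
    (h : ∀ x ∈ s, ∀ y ∈ t, bracket (R := R) x y ∈ q) {x y : L} (hx : x ∈ Submodule.span R s)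
    (hy : y ∈ Submodule.span R t) : bracket (R := R) x y ∈ q := by
  have := Submodule.apply_mem_map₂ (bracket (R := R) (L := L)) hx hy
  rw [Submodule.map₂_span_span] at this
  refine (Submodule.span_le.2 ?_) this
  rintro _ ⟨x, hx, y, hy, rfl⟩
  exact h x hx y hy

variable (R) in
/-- The span of the values of the products of total weight `n` of elements of `S`. The weight is
that in the generators, not the number of factors from `S`. -/
def genSpan (ι : A → L) (S : Set (FreeMagma A)) (n : ℕ) : Submodule R L :=
  Submodule.span R {x | ∃ t, FreeMagma.GeneratedBy S t ∧ t.length = n ∧ eval R ι t = x}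

theorem eval_mem_genSpan (ι : A → L) {S : Set (FreeMagma A)} {t : FreeMagma A}
    (ht : FreeMagma.GeneratedBy S t) : eval R ι t ∈ genSpan R ι S t.length :=
  Submodule.subset_span ⟨t, ht, rfl, rfl⟩

theorem bracket_mem_genSpan (ι : A → L) {S : Set (FreeMagma A)} {i j : ℕ} {x y : L}
    (hx : x ∈ genSpan R ι S i) (hy : y ∈ genSpan R ι S j) :
    bracket (R := R) x y ∈ genSpan R ι S (i + j) := by
  refine bracket_mem_of_mem_span ?_ hx hy
  rintro _ ⟨t, ht, rfl, rfl⟩ _ ⟨u, hu, rfl, rfl⟩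
  rw [← eval_mul, ← FreeMagma.length_mul]
  exact eval_mem_genSpan ι (ht.mul _ _ hu)

section Eliminate

variable {p : A → ZMod 2} {ι : A → L} (hι : ∀ a, ι a ∈ grade (R := R) (L := L) (p a))
  {S : Set (FreeMagma A)} {m : FreeMagma A} (hS : ∀ c ∈ S, c * m ∈ S)

include hι hS

theorem bracket_eval_mem_genSpan {n : ℕ} {x : L} (hx : x ∈ genSpan R ι S n) :
    bracket (R := R) x (eval R ι m) ∈ genSpan R ι S (n + m.length) := by
  refine bracket_mem_of_mem_span (t := {eval R ι m}) ?_ hx (Submodule.mem_span_singleton_self _)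
  rintro _ ⟨t, ht, rfl, rfl⟩ _ rfl
  clear hx
  induction ht with
  | base c hc =>
    rw [← eval_mul, ← FreeMagma.length_mul]
    exact eval_mem_genSpan ι (.base _ (hS c hc))
  | mul c d hc hd ihc ihd =>
    rw [eval_mul, FreeMagma.length_mul, bracket_bracket_left (eval_mem_grade hι c)
      (eval_mem_grade hι d) (eval_mem_grade hι m)]
    refine add_mem ?_ (Submodule.smul_mem _ _ ?_)
    · have := bracket_mem_genSpan ι (eval_mem_genSpan ι hc) ihd
      rwa [← add_assoc] at this
    · have := bracket_mem_genSpan ι ihc (eval_mem_genSpan ι hd)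
      rwa [add_right_comm] at this

theorem bracket_bracket_eval_self_mem_genSpan {n : ℕ} {x : L} (hx : x ∈ genSpan R ι S n) :
    bracket (R := R) x (bracket (R := R) (eval R ι m) (eval R ι m)) ∈
      genSpan R ι S (n + (m.length + m.length)) := by
  have hm := eval_mem_grade (R := R) hι m
  rcases (m.parity p).eq_zero_or_eq_one_of_two with h | h <;> rw [h] at hm
  · simp [bracket_self_of_even _ hm]
  · refine bracket_mem_of_mem_span (t := {_}) ?_ hx (Submodule.mem_span_singleton_self _)
    rintro _ ⟨t, ht, rfl, rfl⟩ _ rfl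
    rw [bracket_bracket_self (eval_mem_grade hι t) hm, ← add_assoc]
    exact Submodule.smul_mem _ _ (bracket_eval_mem_genSpan hι hS
      (bracket_eval_mem_genSpan hι hS (eval_mem_genSpan ι ht)))

omit hι hS in
/-- The spanning set of the part of weight `n` of the subalgebra generated by `S` and `m`, when
bracketing with `m` maps `S` into itself. -/
inductive ElimSpanning (R : Type*) {L A : Type*} [CommRing R] [AddCommGroup L] [Module R L]
    [LieSuperalgebra R L] (ι : A → L) (S : Set (FreeMagma A)) (m : FreeMagma A) : ℕ → L → Prop
  | gen (t : FreeMagma A) : FreeMagma.GeneratedBy S t → ElimSpanning R ι S m t.length (eval R ι t)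
  | elt : ElimSpanning R ι S m m.length (eval R ι m)
  | sq : ElimSpanning R ι S m (m.length + m.length)
      (bracket (R := R) (eval R ι m) (eval R ι m))

theorem bracket_mem_span_elimSpanning {i j : ℕ} {x y : L} (hx : ElimSpanning R ι S m i x)
    (hy : ElimSpanning R ι S m j y) :
    bracket (R := R) x y ∈ Submodule.span R {z | ElimSpanning R ι S m (i + j) z} := by
  have hle : ∀ n, genSpan R ι S n ≤ Submodule.span R {z | ElimSpanning R ι S m n z} := fun n =>
    Submodule.span_mono (by rintro _ ⟨t, ht, rfl, rfl⟩; exact .gen t ht)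
  have hm := eval_mem_grade (R := R) hι m
  have hmm := bracket_mem _ _ _ _ hm hm
  have hzero : bracket (R := R) (bracket (R := R) (eval R ι m) (eval R ι m)) (eval R ι m) = 0 := by
    rcases (m.parity p).eq_zero_or_eq_one_of_two with h | h <;> rw [h] at hm
    · simp [bracket_self_of_even _ hm]
    · exact bracket_bracket_self_of_odd _ hm
  cases hx with
  | gen t ht =>
    cases hy with
    | gen u hu => exact Submodule.subset_span (.gen _ (ht.mul _ _ hu))
    | elt => exact hle _ (bracket_eval_mem_genSpan hι hS (eval_mem_genSpan ι ht))
    | sq => exact hle _ (bracket_bracket_eval_self_mem_genSpan hι hS (eval_mem_genSpan ι ht))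
  | elt =>
    cases hy with
    | gen u hu =>
      rw [bracket_swap _ _ _ _ (eval_mem_grade hι u) hm, add_comm]
      exact neg_mem (Submodule.smul_mem _ _
        (hle _ (bracket_eval_mem_genSpan hι hS (eval_mem_genSpan ι hu))))
    | elt => exact Submodule.subset_span .sq
    | sq => rw [bracket_swap _ _ _ _ hmm hm, hzero]; simp
  | sq =>
    cases hy with
    | gen u hu =>
      rw [bracket_swap _ _ _ _ (eval_mem_grade hι u) hmm, add_comm]
      exact neg_mem (Submodule.smul_mem _ _
        (hle _ (bracket_bracket_eval_self_mem_genSpan hι hS (eval_mem_genSpan ι hu))))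
    | elt => rw [hzero]; simp
    | sq =>
      rcases (m.parity p).eq_zero_or_eq_one_of_two with h | h <;> rw [h] at hm
      · simp [bracket_self_of_even _ hm]
      · rw [bracket_bracket_self (bracket_mem _ _ _ _ hm hm) hm, hzero]
        simp

/-- Lazard elimination: the subalgebra generated by `m` and `S` is spanned by `m`, `[m, m]` and the
subalgebra generated by `S`. -/
theorem eval_mem_span_elimSpanning {t : FreeMagma A}
    (ht : FreeMagma.GeneratedBy (insert m S) t) :
    eval R ι t ∈ Submodule.span R {z | ElimSpanning R ι S m t.length z} := by
  induction ht with
  | base c hc =>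
    rcases hc with rfl | hc
    · exact Submodule.subset_span .elt
    · exact Submodule.subset_span (.gen _ (.base _ hc))
  | mul c d _ _ ihc ihd =>
    exact bracket_mem_of_mem_span (fun x hx y hy => bracket_mem_span_elimSpanning hι hS hx hy)
      ihc ihd

end Eliminate

variable (R) in
/-- The span of the basic commutators and of the squares `[c, c]` of the odd ones. -/
def basicSpan (p : A → ZMod 2) (ι : A → L) (lt : FreeMagma A → FreeMagma A → Prop) :
    Submodule R L :=
  Submodule.span R {x | (∃ c, IsBasicCommutator lt c ∧ eval R ι c = x) ∨
    ∃ c, IsBasicCommutator lt c ∧ c.parity p = 1 ∧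
      bracket (R := R) (eval R ι c) (eval R ι c) = x}

variable [LinearOrder A] {lt : FreeMagma A → FreeMagma A → Prop} {F : Set A}
  {D : Set (FreeMagma A)} {m : FreeMagma A} {p : A → ZMod 2} {ι : A → L}

theorem genSpan_eliminationAlphabet_le (hι : ∀ a, ι a ∈ grade (R := R) (L := L) (p a))
    (hlt : IsBasicOrder lt) (hD : IsInitialIn lt F D) (hD' : IsInitialIn lt F (insert m D))
    (hm : m ∉ D) (n : ℕ) :
    genSpan R ι (eliminationAlphabet lt F D) n ≤
      basicSpan R p ι lt ⊔ genSpan R ι (eliminationAlphabet lt F (insert m D)) n := by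
  have hmB := hD'.mem_basicIn_of_insert.1
  refine Submodule.span_le.2 ?_
  rintro _ ⟨t, ht, rfl, rfl⟩
  have := eval_mem_span_elimSpanning hι
    (fun c hc => hD.mul_mem_eliminationAlphabet_insert hlt hD' hm hc)
    (FreeMagma.GeneratedBy.mono (T := insert m (eliminationAlphabet lt F (insert m D)))
      (fun c hc => or_iff_not_imp_left.2 fun h =>
        IsInitialIn.mem_eliminationAlphabet_insert hc h) ht)
  refine Submodule.span_le.2 ?_ this
  intro z hz
  simp only [Set.mem_ofPred_eq] at hz
  generalize t.length = n at hz ⊢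
  cases hz with
  | gen t ht => exact Submodule.mem_sup_right (eval_mem_genSpan ι ht)
  | elt => exact Submodule.mem_sup_left (Submodule.subset_span (Or.inl ⟨m, hmB, rfl⟩))
  | sq =>
    refine Submodule.mem_sup_left ?_
    have hg := eval_mem_grade (R := R) hι m
    rcases (m.parity p).eq_zero_or_eq_one_of_two with h | h
    · rw [h] at hg
      simp [bracket_self_of_even _ hg]
    · exact Submodule.subset_span (Or.inr ⟨m, hmB, h, rfl⟩)

/-- Every product of generators is a combination of basic commutators and of squares of odd ones:
eliminate, in increasing order, all basic commutators of weight at most that of the product; what is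
left has larger weight. -/
theorem eval_mem_basicSpan (hι : ∀ a, ι a ∈ grade (R := R) (L := L) (p a))
    (hlt : IsBasicOrder lt) (t : FreeMagma A) : eval R ι t ∈ basicSpan R p ι lt := by
  obtain ⟨F, hF, ht⟩ := t.exists_finite_supportedIn
  have key : ∀ D, D.Finite → IsInitialIn lt F D →
      eval R ι t ∈ basicSpan R p ι lt ⊔ genSpan R ι (eliminationAlphabet lt F D) t.length := by
    intro D hfin hD
    refine hD.induction hlt (P := fun D => eval R ι t ∈ basicSpan R p ι lt ⊔
      genSpan R ι (eliminationAlphabet lt F D) t.length) ?_ ?_ hfin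
    · refine Submodule.mem_sup_right (eval_mem_genSpan ι ?_)
      clear hfin hD
      induction t with
      | ih1 a => exact .base _ ⟨⟨.of a, ht⟩, by simp, fun e f h => by cases h⟩
      | ih2 c d hc hd => exact .mul _ _ (hc ht.1) (hd ht.2)
    · intro D m hD hD' hm h
      refine SetLike.le_def.1 (sup_le le_sup_left ?_) h
      exact genSpan_eliminationAlphabet_le hι hlt hD hD' hm _
  have hD : IsInitialIn lt F {c | c ∈ basicIn lt F ∧ c.length ≤ t.length} := by
    refine ⟨fun c hc => hc.1, fun c hc d hd h => ⟨hd, ?_⟩⟩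
    by_contra hlen
    have := hlt.lt_of_length_lt c d hc.1.1 hd.1 (hc.2.trans_lt (not_le.1 hlen))
    exact hlt.irrefl c hc.1.1 (hlt.trans c d c hc.1.1 hd.1 hc.1.1 this h)
  have hfin := (FreeMagma.finite_supportedIn_length_le hF t.length).subset
    (fun c (hc : c ∈ basicIn lt F ∧ c.length ≤ t.length) => ⟨hc.1.2, hc.2⟩)
  refine SetLike.le_def.1 (sup_le le_rfl ?_) (key _ hfin hD)
  refine Submodule.span_le.2 ?_
  rintro _ ⟨u, hu, hlen, rfl⟩
  exfalso
  have : ∀ u, FreeMagma.GeneratedBy (eliminationAlphabet lt F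
      {c | c ∈ basicIn lt F ∧ c.length ≤ t.length}) u → t.length < u.length := by
    intro u hu
    induction hu with
    | base c hc => exact not_le.1 fun h => hc.2.1 ⟨hc.1, h⟩
    | mul c d _ _ hc _ => simpa using Nat.lt_add_right _ hc
  exact (this u hu).ne' hlen

end LieSuperalgebra

/-! ### Elimination in a free associative algebra: the basic commutators are independent -/

namespace FreeElimination

open Finsupp

variable {R Y : Type*} [CommRing R] (ε : Y → R) (σ : Y → Y)

/-- Left multiplication by the letter `y` on the free module on the monomials `w z ^ j`, where `w` is
a word in `Y`; the monomial is encoded as `(w, j)`. -/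
noncomputable def consOp (y : Y) : Module.End R (List Y × ℕ →₀ R) :=
  lmapDomain R R fun q => (y :: q.1, q.2)

/-- The product of `z` and the monomial `w z ^ j`, rewritten by the rule
`z y = ε y (y z - σ y)` for letters `y`. -/
noncomputable def elimAux : List Y → ℕ → (List Y × ℕ →₀ R)
  | [], j => single ([], j + 1) 1
  | y :: w, j => ε y • (consOp y (elimAux w j) - single (σ y :: w, j) 1)

/-- Left multiplication by `z` on the free module on the monomials `w z ^ j`. -/
noncomputable def elimOp : Module.End R (List Y × ℕ →₀ R) :=
  linearCombination R fun q => elimAux ε σ q.1 q.2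

variable {ε}

theorem consOp_mul_elimOp (hε : ∀ y, ε y * ε y = 1) (y : Y) :
    consOp y * elimOp ε σ - ε y • (elimOp ε σ * consOp y) = consOp (R := R) (σ y) := by
  ext ⟨w, j⟩ : 2
  simp [consOp, elimOp, elimAux, smul_smul, hε, mapDomain_single]

theorem elimOp_single_nil (j : ℕ) :
    elimOp ε σ (single ([], j) 1) = single ([], j + 1) (1 : R) := by
  simp [elimOp, elimAux]

/-- The linear map that sends a word `w` to itself and `w z ^ j` to zero for `j > 0`. -/
noncomputable def readout : (List Y × ℕ →₀ R) →ₗ[R] FreeAlgebra R Y :=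
  linearCombination R fun q => if q.2 = 0 then (q.1.map (FreeAlgebra.ι R)).prod else 0

theorem readout_consOp (y : Y) (v : List Y × ℕ →₀ R) :
    readout (consOp y v) = FreeAlgebra.ι R y * readout v := by
  induction v using Finsupp.induction_linear with
  | zero => simp
  | add v w hv hw => simp [hv, hw, mul_add]
  | single q r => simp [consOp, readout, mapDomain_single, mul_ite]

section Representation

variable {X : Type*} {P : Y → FreeAlgebra R X}
  {ρ : FreeAlgebra R X →ₐ[R] Module.End R (List Y × ℕ →₀ R)} (hP : ∀ y, ρ (P y) = consOp y)

include hP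

theorem readout_lift (u : FreeAlgebra R Y) (v : List Y × ℕ →₀ R) :
    readout (ρ (FreeAlgebra.lift R P u) v) = u * readout v := by
  induction u using FreeAlgebra.induction generalizing v with
  | grade0 r => simp [Algebra.algebraMap_eq_smul_one]
  | grade1 y => simp [hP, readout_consOp]
  | mul a b ha hb => simp [ha, hb, mul_assoc]
  | add a b ha hb => simp [ha, hb, add_mul]

theorem lift_injective : Function.Injective (FreeAlgebra.lift R P) := by
  intro u v h
  have := readout_lift hP u (single ([], 0) 1)
  rw [h, readout_lift hP] at this
  simpa [readout] using this.symm

/-- The subalgebra generated by `Y` preserves the span of the monomials without `z`. -/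
theorem lift_apply_eq_zero (u : FreeAlgebra R Y) {v : List Y × ℕ →₀ R}
    (hv : ∀ w j, v (w, j + 1) = 0) (w : List Y) (j : ℕ) :
    ρ (FreeAlgebra.lift R P u) v (w, j + 1) = 0 := by
  induction u using FreeAlgebra.induction generalizing v w j with
  | grade0 r => simp [Algebra.algebraMap_eq_smul_one, hv]
  | grade1 y =>
    simp only [FreeAlgebra.lift_ι_apply, hP, consOp, lmapDomain_apply]
    by_cases h : (w, j + 1) ∈ Set.range fun q : List Y × ℕ => (y :: q.1, q.2)
    · obtain ⟨⟨w', j'⟩, h⟩ := h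
      obtain ⟨rfl, rfl⟩ := Prod.mk.inj h
      have hinj : Function.Injective fun q : List Y × ℕ => (y :: q.1, q.2) := by
        rintro ⟨a, b⟩ ⟨c, d⟩ h
        simpa using h
      exact (mapDomain_apply hinj v (w', j + 1)).trans (hv w' j)
    · exact mapDomain_of_notMem_range _ _ h
  | mul a b ha hb =>
    rw [map_mul, map_mul]
    exact ha (fun w j => hb hv w j) w j
  | add a b ha hb => simp [ha hv, hb hv]

/-- `z` and `z ^ 2` are independent modulo the subalgebra generated by `Y`. -/
theorem coeff_eq_zero {z : FreeAlgebra R X} (hz : ρ z = elimOp ε σ) {α β : R}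
    {u : FreeAlgebra R Y} (h : α • z + β • (z * z) + FreeAlgebra.lift R P u = 0) :
    α = 0 ∧ β = 0 := by
  have key : ∀ j, (α • elimOp ε σ + β • (elimOp ε σ * elimOp ε σ))
      (single ([], 0) 1) ([], j + 1) = 0 := by
    intro j
    have h1 := congrArg (fun f => ρ f (single ([], 0) 1) ([], j + 1)) h
    have h2 := lift_apply_eq_zero hP u (v := single ([], 0) 1)
      (fun w j => by simp) [] j
    simpa [hz, h2] using h1
  constructor
  · simpa [elimOp_single_nil] using key 0
  · simpa [elimOp_single_nil] using key 1

end Representation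

end FreeElimination

section superEval

variable {A T : Type*} (R : Type*) [CommRing R] [Ring T] [Algebra R T]

/-- The value of a formal product in an associative algebra, the product being read as the
supercommutator `[c, d] = c d - (-1)^(|c||d|) d c`. -/
def superEval (p : A → ZMod 2) (x : A → T) : FreeMagma A → T
  | FreeMagma.of a => x a
  | FreeMagma.mul c d => superEval p x c * superEval p x d -
      superSign R (FreeMagma.parity p c) (FreeMagma.parity p d) •
        (superEval p x d * superEval p x c)

theorem superEval_mul (p : A → ZMod 2) (x : A → T) (c d : FreeMagma A) :
    superEval R p x (c * d) = superEval R p x c * superEval R p x d -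
      superSign R (c.parity p) (d.parity p) • (superEval R p x d * superEval R p x c) := rfl

/-- The map from the free algebra on a set of formal products that evaluates each of them. -/
noncomputable def superEvalLift (p : A → ZMod 2) (x : A → T) (S : Set (FreeMagma A)) :
    FreeAlgebra R S →ₐ[R] T :=
  FreeAlgebra.lift R fun c : S => superEval R p x c

variable {R}

theorem superEval_mem_range_superEvalLift {p : A → ZMod 2} {x : A → T} {S : Set (FreeMagma A)}
    {c : FreeMagma A} (hc : FreeMagma.GeneratedBy S c) :
    superEval R p x c ∈ (superEvalLift R p x S).range := by
  induction hc with
  | base c hc => exact ⟨FreeAlgebra.ι R ⟨c, hc⟩, by simp [superEvalLift]⟩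
  | mul c d _ _ hc hd =>
    exact sub_mem (mul_mem hc hd) (Subalgebra.smul_mem _ (mul_mem hd hc) _)

variable {lt : FreeMagma A → FreeMagma A → Prop} {F : Set A}
  {D : Set (FreeMagma A)} {m : FreeMagma A} {p : A → ZMod 2} {x : A → T}

theorem superEvalLift_empty_injective (hx : Function.Injective (FreeAlgebra.lift R x)) :
    Function.Injective (superEvalLift R p x (eliminationAlphabet lt F ∅)) := by
  classical
  have hex : ∀ c : eliminationAlphabet lt F ∅, ∃ a, c.1 = FreeMagma.of a := by
    rintro ⟨a | ⟨e, f⟩, hc⟩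
    · exact ⟨a, rfl⟩
    · exact absurd (hc.2.2 e f rfl) (Set.notMem_empty _)
  choose letter hletter using hex
  let j : FreeAlgebra R (eliminationAlphabet lt F ∅) →ₐ[R] FreeAlgebra R A :=
    FreeAlgebra.lift R fun c => FreeAlgebra.ι R (letter c)
  let k : FreeAlgebra R A →ₐ[R] FreeAlgebra R (eliminationAlphabet lt F ∅) :=
    FreeAlgebra.lift R fun a =>
      if h : FreeMagma.of a ∈ eliminationAlphabet lt F ∅ then FreeAlgebra.ι R ⟨_, h⟩ else 0
  have hkj : k.comp j = AlgHom.id R _ := by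
    ext c
    have h : FreeMagma.of (letter c) ∈ eliminationAlphabet lt F ∅ := hletter c ▸ c.2
    have hc : (⟨FreeMagma.of (letter c), h⟩ : eliminationAlphabet lt F ∅) = c :=
      Subtype.ext (hletter c).symm
    simp [j, k, h, hc]
  have hj : Function.Injective j :=
    Function.LeftInverse.injective (g := k) fun u => AlgHom.congr_fun hkj u
  have hcomp : superEvalLift R p x (eliminationAlphabet lt F ∅) = (FreeAlgebra.lift R x).comp j := by
    ext c
    simp [superEvalLift, j, hletter c, superEval]
  rw [hcomp]
  exact hx.comp hj

variable [LinearOrder A]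

/-- The elimination step: if the alphabet before the elimination of `m` generates a free algebra,
then so does the alphabet after it, and `m`, `m ^ 2` are independent modulo the latter. -/
theorem superEvalLift_insert (hlt : IsBasicOrder lt) (hD : IsInitialIn lt F D)
    (hD' : IsInitialIn lt F (insert m D)) (hm : m ∉ D)
    (hinj : Function.Injective (superEvalLift R p x (eliminationAlphabet lt F D))) :
    Function.Injective (superEvalLift R p x (eliminationAlphabet lt F (insert m D))) ∧
      ∀ (α β : R), α • superEval R p x m + β • (superEval R p x m * superEval R p x m) ∈
        (superEvalLift R p x (eliminationAlphabet lt F (insert m D))).range → α = 0 ∧ β = 0 := by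
  classical
  let X := eliminationAlphabet lt F D
  let Y := eliminationAlphabet lt F (insert m D)
  let ε : Y → R := fun y => superSign R (y.1.parity p) (m.parity p)
  let σ : Y → Y := fun y => ⟨y.1 * m, hD.mul_mem_eliminationAlphabet_insert hlt hD' hm y.2⟩
  let mX : X := ⟨m, hD'.mem_eliminationAlphabet hlt hm⟩
  -- The letters of `X` other than `m` also belong to `Y` and act by left multiplication; `m` acts as
  -- the additional variable.
  let ρ : FreeAlgebra R X →ₐ[R] Module.End R (List Y × ℕ →₀ R) :=
    FreeAlgebra.lift R fun c => if h : c.1 = m then FreeElimination.elimOp ε σ else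
      FreeElimination.consOp ⟨c.1, IsInitialIn.mem_eliminationAlphabet_insert c.2 h⟩
  have hρm : ρ (FreeAlgebra.ι R mX) = FreeElimination.elimOp ε σ := by simp [ρ, mX]
  -- Every letter of `Y` is a polynomial in those of `X` and acts by left multiplication.
  have hex : ∀ (c : FreeMagma A) (hc : c ∈ Y), ∃ P : FreeAlgebra R X,
      superEvalLift R p x X P = superEval R p x c ∧ ρ P = FreeElimination.consOp ⟨c, hc⟩ := by
    intro c
    induction hn : c.length using Nat.strong_induction_on generalizing c with
    | _ n ih =>
      intro hc
      rcases hD.eliminationAlphabet_insert_cases hlt hD' hc with ⟨hcX, hcm⟩ | ⟨e, he, rfl⟩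
      · exact ⟨FreeAlgebra.ι R ⟨c, hcX⟩, by simp [superEvalLift], by simp [ρ, hcm]⟩
      · obtain ⟨P, hP, hP'⟩ := ih e.length (by have := m.length_pos; simp at hn; lia) e rfl he
        refine ⟨P * FreeAlgebra.ι R mX - superSign R (e.parity p) (m.parity p) •
          (FreeAlgebra.ι R mX * P), ?_, ?_⟩
        · simp only [map_sub, map_mul, map_smul, hP, superEval_mul]
          simp [superEvalLift, mX]
        · simp only [map_sub, map_mul, map_smul, hP', hρm]
          exact FreeElimination.consOp_mul_elimOp (ε := ε) σ
            (fun y => superSign_mul_self R _ _) ⟨e, he⟩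
  choose P hP hρP using fun y : Y => hex y.1 y.2
  have hcomp : superEvalLift R p x Y = (superEvalLift R p x X).comp (FreeAlgebra.lift R P) := by
    ext y
    simp [hP]
    simp [superEvalLift]
  refine ⟨?_, ?_⟩
  · change Function.Injective (superEvalLift R p x Y)
    rw [hcomp]
    exact hinj.comp (FreeElimination.lift_injective hρP)
  · rintro α β ⟨u, hu⟩
    refine FreeElimination.coeff_eq_zero σ hρP hρm (u := -u) (hinj ?_)
    have hu' : superEvalLift R p x X (FreeAlgebra.lift R P u) = _ :=
      (AlgHom.congr_fun hcomp u).symm.trans hu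
    have hmX : superEvalLift R p x X (FreeAlgebra.ι R mX) = superEval R p x m := by
      simp [superEvalLift, mX]
    rw [map_add, map_add, map_smul, map_smul, map_mul, hmX, map_neg, map_neg, hu', map_zero,
      add_neg_cancel]

/-- If the elements `x a` generate a free algebra, then the basic commutators in them and their
associative squares are linearly independent: in a linear relation let `m` be the smallest basic
commutator, and eliminate all smaller ones and `m`. The other terms of the relation lie in the
algebra generated by the alphabet that is left. -/
theorem superEval_independent (hlt : IsBasicOrder lt)
    (hx : Function.Injective (FreeAlgebra.lift R x)) (s : Finset (FreeMagma A))
    (hs : ∀ c ∈ s, IsBasicCommutator lt c) (α β : FreeMagma A → R)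
    (h : ∑ c ∈ s, (α c • superEval R p x c +
      β c • (superEval R p x c * superEval R p x c)) = 0) :
    ∀ c ∈ s, α c = 0 ∧ β c = 0 := by
  classical
  induction hn : s.card generalizing s with
  | zero =>
    rw [Finset.card_eq_zero] at hn
    simp [hn]
  | succ n ih =>
    obtain ⟨m, hm, hmin⟩ := s.finite_toSet.exists_greatest_of_total (r := fun c d => lt d c)
      (Finset.card_ne_zero.1 (by lia))
      (fun a ha b hb c hc h1 h2 => hlt.trans c b a (hs c hc) (hs b hb) (hs a ha) h2 h1)
      (fun a ha b hb => (hlt.total b a (hs b hb) (hs a ha)).imp id (Or.imp Eq.symm id))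
    have hm : m ∈ s := hm
    choose G hG hG' using fun c : FreeMagma A => c.exists_finite_supportedIn
    let F : Set A := ⋃ c ∈ s, G c
    have hF : F.Finite := s.finite_toSet.biUnion fun c _ => hG c
    have hsF : ∀ c ∈ s, c ∈ basicIn lt F := fun c hc =>
      ⟨hs c hc, (hG' c).mono (Set.subset_biUnion_of_mem (u := G) hc)⟩
    let D : Set (FreeMagma A) := {d | d ∈ basicIn lt F ∧ lt d m}
    have hlen : ∀ d ∈ D, d.length ≤ m.length := by
      intro d hd
      by_contra hcon
      have := hlt.lt_of_length_lt m d (hs m hm) hd.1.1 (not_le.1 hcon)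
      exact hlt.irrefl m (hs m hm) (hlt.trans m d m (hs m hm) hd.1.1 (hs m hm) this hd.2)
    have hDfin : D.Finite := (FreeMagma.finite_supportedIn_length_le hF m.length).subset
      fun d hd => ⟨hd.1.2, hlen d hd⟩
    have hD : IsInitialIn lt F D := ⟨fun d hd => hd.1, fun c hc d hd h =>
      ⟨hd, hlt.trans d c m hd.1 hc.1.1 (hs m hm) h hc.2⟩⟩
    have hmD : m ∉ D := fun h => hlt.irrefl m (hs m hm) h.2
    have hD' : IsInitialIn lt F (insert m D) := by
      refine ⟨Set.insert_subset (hsF m hm) hD.subset, ?_⟩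
      rintro c (rfl | hc) d hd h
      · exact Or.inr ⟨hd, h⟩
      · exact Or.inr (hD.mem_of_lt c hc d hd h)
    have hinj : Function.Injective (superEvalLift R p x (eliminationAlphabet lt F D)) :=
      hD.induction hlt
        (P := fun D => Function.Injective (superEvalLift R p x (eliminationAlphabet lt F D)))
        (superEvalLift_empty_injective hx)
        (fun D m hD hD' hm h => (superEvalLift_insert hlt hD hD' hm h).1) hDfin
    have hrest : ∑ c ∈ s.erase m, (α c • superEval R p x c +
        β c • (superEval R p x c * superEval R p x c)) ∈
        (superEvalLift R p x (eliminationAlphabet lt F (insert m D))).range := by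
      refine sum_mem fun c hc => ?_
      obtain ⟨hcm, hcs⟩ := Finset.mem_erase.1 hc
      have hmc := (hmin c hcs).resolve_left hcm
      have hcD : c ∉ insert m D := by
        rintro (h | h)
        · exact hcm h
        · exact hlt.irrefl m (hs m hm) (hlt.trans m c m (hs m hm) (hs c hcs) (hs m hm) hmc h.2)
      have := superEval_mem_range_superEvalLift (R := R) (p := p) (x := x)
        (hD'.generatedBy_eliminationAlphabet (hsF c hcs) hcD)
      exact add_mem (Subalgebra.smul_mem _ this _) (Subalgebra.smul_mem _ (mul_mem this this) _)
    rw [← Finset.add_sum_erase _ _ hm] at h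
    have hm0 := (superEvalLift_insert hlt hD hD' hmD hinj).2 (α m) (β m)
      (by rw [eq_neg_of_add_eq_zero_left h]; exact neg_mem hrest)
    rw [hm0.1, hm0.2, zero_smul, zero_smul, add_zero, zero_add] at h
    intro c hc
    by_cases hcm : c = m
    · rwa [hcm]
    · exact ih (s.erase m) (fun c hc => hs c (Finset.mem_of_mem_erase hc)) h
        (by rw [Finset.card_erase_of_mem hm, hn]; rfl) c (Finset.mem_erase.2 ⟨hcm, hc⟩)

end superEval

/-! ### Associative superalgebras and base change -/

namespace LieSuperalgebra

section ofGradedAlgebra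

variable {R T : Type*} [CommRing R] [Ring T] [Algebra R T] (𝒜 : ZMod 2 → Submodule R T)
  [GradedAlgebra 𝒜]

/-- The supercommutator of an associative superalgebra. It is `x y - y x` corrected in the odd parts
`x₁`, `y₁`, where the bracket has to be `x₁ y₁ + y₁ x₁`. -/
noncomputable def supercommutator : T →ₗ[R] T →ₗ[R] T :=
  LinearMap.mul R T - (LinearMap.mul R T).flip +
    (2 : R) • ((LinearMap.mul R T).flip.compl₁₂ (GradedAlgebra.proj 𝒜 1) (GradedAlgebra.proj 𝒜 1))

variable {𝒜} in
theorem supercommutator_apply {i j : ZMod 2} {x y : T} (hx : x ∈ 𝒜 i) (hy : y ∈ 𝒜 j) :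
    supercommutator 𝒜 x y = x * y - superSign R i j • (y * x) := by
  rcases i.eq_zero_or_eq_one_of_two with rfl | rfl <;>
    rcases j.eq_zero_or_eq_one_of_two with rfl | rfl <;>
    simp [supercommutator, DirectSum.decompose_of_mem_same 𝒜, hx, hy,
      DirectSum.decompose_of_mem_ne 𝒜 hx, DirectSum.decompose_of_mem_ne 𝒜 hy, two_smul]

variable {𝒜} in
theorem supercommutator_mem {i j : ZMod 2} {x y : T} (hx : x ∈ 𝒜 i) (hy : y ∈ 𝒜 j) :
    supercommutator 𝒜 x y ∈ 𝒜 (i + j) := by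
  rw [supercommutator_apply hx hy]
  refine sub_mem (SetLike.mul_mem_graded hx hy) (Submodule.smul_mem _ _ ?_)
  rw [add_comm]
  exact SetLike.mul_mem_graded hy hx

/-- An associative superalgebra is a Lie superalgebra under the supercommutator. -/
@[reducible] noncomputable def ofGradedAlgebra : LieSuperalgebra R T where
  grade := 𝒜
  isCompl_grade := (DirectSum.Decomposition.isInternal 𝒜).isCompl (by decide)
    (by ext i; simpa using i.eq_zero_or_eq_one_of_two)
  bracket := supercommutator 𝒜
  bracket_mem _ _ _ _ hx hy := supercommutator_mem hx hy
  bracket_swap i j x y hx hy := by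
    rw [supercommutator_apply hx hy, supercommutator_apply hy hx, smul_sub, smul_smul,
      superSign_mul_self, superSign_comm R j i, one_smul, neg_sub]
  jacobi i j k x y z hx hy hz := by
    rw [supercommutator_apply hx (supercommutator_mem hy hz),
      supercommutator_apply hy (supercommutator_mem hz hx),
      supercommutator_apply hz (supercommutator_mem hx hy),
      supercommutator_apply hx hy, supercommutator_apply hy hz, supercommutator_apply hz hx]
    rcases i.eq_zero_or_eq_one_of_two with rfl | rfl <;>
      rcases j.eq_zero_or_eq_one_of_two with rfl | rfl <;>
      rcases k.eq_zero_or_eq_one_of_two with rfl | rfl <;>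
      simp [show (1 : ZMod 2) + 1 = 0 from rfl] <;> noncomm_ring
  bracket_self_of_even x hx := by simp [supercommutator_apply hx hx]
  bracket_bracket_self_of_odd x hx := by
    rw [supercommutator_apply (supercommutator_mem hx hx) hx, supercommutator_apply hx hx]
    simp [show (1 : ZMod 2) + 1 = 0 from rfl]
    noncomm_ring

theorem eval_ofGradedAlgebra {A : Type*} {p : A → ZMod 2} {x : A → T} (hx : ∀ a, x a ∈ 𝒜 (p a))
    (c : FreeMagma A) :
    letI := ofGradedAlgebra 𝒜
    eval R x c = superEval R p x c := by
  let _ := ofGradedAlgebra 𝒜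
  induction c with
  | ih1 a => rfl
  | ih2 c d hc hd =>
    rw [eval_mul, superEval_mul, ← hc, ← hd]
    exact supercommutator_apply (eval_mem_grade (p := p) hx c) (eval_mem_grade (p := p) hx d)

end ofGradedAlgebra

section ofSpanning

variable {R M : Type*} [CommRing R] [AddCommGroup M] [Module R M]

theorem _root_.Submodule.map_mem_of_mem_span {N : Type*} [AddCommGroup N] [Module R N] {s : Set M}
    {q : Submodule R N} (f : M →ₗ[R] N) (hf : ∀ x ∈ s, f x ∈ q) {x : M}
    (hx : x ∈ Submodule.span R s) : f x ∈ q :=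
  SetLike.le_def.1 (Submodule.span_le (p := q.comap f).2 hf) hx

theorem _root_.Submodule.map_eq_zero_of_mem_span {N : Type*} [AddCommGroup N] [Module R N]
    {s : Set M} (f : M →ₗ[R] N) (hf : ∀ x ∈ s, f x = 0) {x : M}
    (hx : x ∈ Submodule.span R s) : f x = 0 :=
  Submodule.map_mem_of_mem_span (q := ⊥) f hf hx

variable {G : ZMod 2 → Set M} {β : M →ₗ[R] M →ₗ[R] M} {i j k : ZMod 2} {x y z : M}

theorem bracket_mem_of_spanning
    (hmem : ∀ i j, ∀ x ∈ G i, ∀ y ∈ G j, β x y ∈ Submodule.span R (G (i + j)))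
    (hx : x ∈ Submodule.span R (G i)) (hy : y ∈ Submodule.span R (G j)) :
    β x y ∈ Submodule.span R (G (i + j)) :=
  Submodule.map_mem_of_mem_span (β.flip y)
    (fun x hx => Submodule.map_mem_of_mem_span (β x) (fun y hy => hmem i j x hx y hy) hy) hx

theorem bracket_swap_of_spanning
    (hswap : ∀ i j, ∀ x ∈ G i, ∀ y ∈ G j, β y x = -(superSign R i j • β x y))
    (hx : x ∈ Submodule.span R (G i)) (hy : y ∈ Submodule.span R (G j)) :
    β y x = -(superSign R i j • β x y) := by
  rw [← add_eq_zero_iff_eq_neg]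
  refine Submodule.map_eq_zero_of_mem_span (β y + superSign R i j • β.flip y) (fun x hx => ?_) hx
  refine Submodule.map_eq_zero_of_mem_span (β.flip x + superSign R i j • β x) (fun y hy => ?_) hy
  exact add_eq_zero_iff_eq_neg.2 (hswap i j x hx y hy)

theorem jacobi_of_spanning
    (hjacobi : ∀ i j k, ∀ x ∈ G i, ∀ y ∈ G j, ∀ z ∈ G k, superSign R i k • β x (β y z) +
      superSign R j i • β y (β z x) + superSign R k j • β z (β x y) = 0)
    (hx : x ∈ Submodule.span R (G i)) (hy : y ∈ Submodule.span R (G j))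
    (hz : z ∈ Submodule.span R (G k)) :
    superSign R i k • β x (β y z) + superSign R j i • β y (β z x) +
      superSign R k j • β z (β x y) = 0 := by
  refine Submodule.map_eq_zero_of_mem_span (superSign R i k • β.flip (β y z) +
    superSign R j i • (β y ∘ₗ β z) + superSign R k j • (β z ∘ₗ β.flip y)) (fun x hx => ?_) hx
  refine Submodule.map_eq_zero_of_mem_span (superSign R i k • (β x ∘ₗ β.flip z) +
    superSign R j i • β.flip (β z x) + superSign R k j • (β z ∘ₗ β x)) (fun y hy => ?_) hy
  refine Submodule.map_eq_zero_of_mem_span (superSign R i k • (β x ∘ₗ β y) +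
    superSign R j i • (β y ∘ₗ β.flip x) + superSign R k j • β.flip (β x y)) (fun z hz => ?_) hz
  exact hjacobi i j k x hx y hy z hz

/-- A bilinear product is a Lie superalgebra if the axioms hold on homogeneous elements that span.
The axioms `[a, a] = 0` and `[[a, a], a] = 0`, although not linear, extend to the span: the mixed
terms vanish by the other axioms. -/
@[reducible] def ofSpanning (G : ZMod 2 → Set M) (β : M →ₗ[R] M →ₗ[R] M)
    (hcompl : IsCompl (Submodule.span R (G 0)) (Submodule.span R (G 1)))
    (hmem : ∀ i j, ∀ x ∈ G i, ∀ y ∈ G j, β x y ∈ Submodule.span R (G (i + j)))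
    (hswap : ∀ i j, ∀ x ∈ G i, ∀ y ∈ G j, β y x = -(superSign R i j • β x y))
    (hjacobi : ∀ i j k, ∀ x ∈ G i, ∀ y ∈ G j, ∀ z ∈ G k, superSign R i k • β x (β y z) +
      superSign R j i • β y (β z x) + superSign R k j • β z (β x y) = 0)
    (heven : ∀ x ∈ G 0, β x x = 0) (hodd : ∀ x ∈ G 1, β (β x x) x = 0) :
    LieSuperalgebra R M where
  grade i := Submodule.span R (G i)
  isCompl_grade := hcompl
  bracket := β
  bracket_mem _ _ _ _ hx hy := bracket_mem_of_spanning hmem hx hy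
  bracket_swap _ _ _ _ hx hy := bracket_swap_of_spanning hswap hx hy
  jacobi _ _ _ _ _ _ hx hy hz := jacobi_of_spanning hjacobi hx hy hz
  bracket_self_of_even x hx := by
    induction hx using Submodule.span_induction with
    | mem x hx => exact heven x hx
    | zero => simp
    | add x y hx hy h h' => simp [h, h', bracket_swap_of_spanning hswap hx hy]
    | smul s x _ h => simp [h]
  bracket_bracket_self_of_odd x hx := by
    induction hx using Submodule.span_induction with
    | mem x hx => exact hodd x hx
    | zero => simp
    | add x y hx hy h h' =>
      -- The mixed terms are those of the Jacobi identities for `x, x, y` and `x, y, y`.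
      have h1 := jacobi_of_spanning hjacobi hx hx hy
      have h2 := jacobi_of_spanning hjacobi hx hy hy
      have h3 := bracket_swap_of_spanning hswap hx hy
      have h4 := bracket_swap_of_spanning hswap hy (bracket_mem_of_spanning hmem hx hx)
      have h5 := bracket_swap_of_spanning hswap hx (bracket_mem_of_spanning hmem hy hy)
      have h6 := bracket_swap_of_spanning hswap hx (bracket_mem_of_spanning hmem hx hy)
      have h7 := bracket_swap_of_spanning hswap hy (bracket_mem_of_spanning hmem hx hy)
      simp only [superSign_one_one, show (1 : ZMod 2) + 1 = 0 from rfl, superSign_zero_right,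
        neg_smul, one_smul, neg_neg] at h1 h2 h3 h4 h5 h6 h7
      rw [h3] at h1 h2
      simp only [map_add, LinearMap.add_apply, h, h', h3, h4, h5, h6, h7]
      refine Eq.trans ?_ ((congrArg₂ (· + ·) h1 h2).trans (add_zero 0))
      abel
    | smul s x _ h => simp [h]

end ofSpanning

section baseChange

open TensorProduct

variable {R L : Type*} [CommRing R] [AddCommGroup L] [Module R L]
  (S : Type*) [CommRing S] [Algebra R S]

theorem _root_.IsCompl.baseChange {q q' : Submodule R L} (h : IsCompl q q') :
    IsCompl (q.baseChange S) (q'.baseChange S) := by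
  let π := (q.projection q' h).baseChange S
  have h1 : ∀ x ∈ q.baseChange S, x - π x = 0 := fun x hx =>
    Submodule.map_eq_zero_of_mem_span (LinearMap.id - π) (by
      rintro _ ⟨x, hx, rfl⟩
      simp [π, Submodule.projection_apply_of_mem_left h hx]) (Submodule.baseChange_eq_span S q ▸ hx)
  have h2 : ∀ x ∈ q'.baseChange S, π x = 0 := fun x hx =>
    Submodule.map_eq_zero_of_mem_span π (by
      rintro _ ⟨x, hx, rfl⟩
      simp [π, (Submodule.projection_apply_eq_zero_iff h).2 hx])
      (Submodule.baseChange_eq_span S q' ▸ hx)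
  constructor
  · rw [Submodule.disjoint_def]
    intro x hx hx'
    rw [← h1 x hx, h2 x hx', sub_zero]
  · rw [codisjoint_iff, eq_top_iff, ← Submodule.baseChange_top]
    rw [Submodule.baseChange_eq_span, Submodule.span_le]
    rintro _ ⟨x, hx, rfl⟩
    rw [← h.sup_eq_top] at hx
    obtain ⟨y, hy, z, hz, rfl⟩ := Submodule.mem_sup.1 hx
    rw [map_add]
    exact Submodule.add_mem_sup (Submodule.tmul_mem_baseChange_of_mem 1 hy)
      (Submodule.tmul_mem_baseChange_of_mem 1 hz)

theorem _root_.one_tmul_superSign_smul (i j : ZMod 2) (x : L) :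
    (1 : S) ⊗ₜ[R] (superSign R i j • x) = superSign S i j • ((1 : S) ⊗ₜ[R] x) := by
  rcases i.eq_zero_or_eq_one_of_two with rfl | rfl <;>
    rcases j.eq_zero_or_eq_one_of_two with rfl | rfl <;> simp [tmul_neg, neg_tmul, smul_tmul']

variable [LieSuperalgebra R L]

/-- Extension of scalars of a Lie superalgebra. -/
@[reducible] noncomputable def baseChange : LieSuperalgebra S (S ⊗[R] L) :=
  let β : S ⊗[R] L →ₗ[S] S ⊗[R] L →ₗ[S] S ⊗[R] L :=
    LinearMap.BilinMap.baseChange S (bracket (R := R) (L := L))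
  have hβ : ∀ x y : L, β (1 ⊗ₜ x) (1 ⊗ₜ y) = 1 ⊗ₜ bracket (R := R) x y := fun x y =>
    (LinearMap.BilinMap.baseChange_tmul _ _ _ _ _).trans (by rw [mul_one])
  ofSpanning (fun i => (grade (R := R) (L := L) i).map (TensorProduct.mk R S L 1)) β
    (by
      rw [← Submodule.baseChange_eq_span, ← Submodule.baseChange_eq_span]
      exact isCompl_grade.baseChange S)
    (by
      rintro i j _ ⟨x, hx, rfl⟩ _ ⟨y, hy, rfl⟩
      exact Submodule.subset_span ⟨_, bracket_mem i j x y hx hy, (hβ x y).symm⟩)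
    (by
      rintro i j _ ⟨x, hx, rfl⟩ _ ⟨y, hy, rfl⟩
      simp only [TensorProduct.mk_apply, hβ]
      rw [bracket_swap i j x y hx hy, tmul_neg, one_tmul_superSign_smul])
    (by
      rintro i j k _ ⟨x, hx, rfl⟩ _ ⟨y, hy, rfl⟩ _ ⟨z, hz, rfl⟩
      simp only [TensorProduct.mk_apply, hβ, ← one_tmul_superSign_smul]
      rw [← tmul_add, ← tmul_add, jacobi i j k x y z hx hy hz, tmul_zero])
    (by
      rintro _ ⟨x, hx, rfl⟩
      simp only [TensorProduct.mk_apply, hβ]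
      rw [bracket_self_of_even x hx, tmul_zero])
    (by
      rintro _ ⟨x, hx, rfl⟩
      simp only [TensorProduct.mk_apply, hβ]
      rw [bracket_bracket_self_of_odd x hx, tmul_zero])

theorem bracket_baseChange (x y : L) :
    letI := baseChange (R := R) (L := L) S
    bracket (R := S) ((1 : S) ⊗ₜ[R] x) ((1 : S) ⊗ₜ[R] y) = 1 ⊗ₜ bracket (R := R) x y :=
  (LinearMap.BilinMap.baseChange_tmul _ _ _ _ _).trans (by rw [mul_one])

theorem eval_baseChange {A : Type*} (ι : A → L) (c : FreeMagma A) :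
    letI := baseChange (R := R) (L := L) S
    eval S (fun a => (1 : S) ⊗ₜ[R] ι a) c = 1 ⊗ₜ eval R ι c := by
  let _ := baseChange (R := R) (L := L) S
  induction c with
  | ih1 a => rfl
  | ih2 c d hc hd => rw [eval_mul, eval_mul, hc, hd, bracket_baseChange]

end baseChange

end LieSuperalgebra

/-! ### The basis theorem -/

namespace LieSuperalgebra

section basicFamily

variable {R L A : Type*} [CommRing R] [AddCommGroup L] [Module R L] [LieSuperalgebra R L]

variable (R) in
/-- The basic commutators and the squares `[c, c]` of the odd ones, where the parity is that of the
formal product `c`. -/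
def basicFamily (p : A → ZMod 2) (ι : A → L) (lt : FreeMagma A → FreeMagma A → Prop) :
    {c : FreeMagma A // IsBasicCommutator lt c} ⊕
      {c : FreeMagma A // IsBasicCommutator lt c ∧ c.parity p = 1} → L :=
  Sum.elim (fun c => eval R ι c.1) (fun c => bracket (R := R) (eval R ι c.1) (eval R ι c.1))

variable {p : A → ZMod 2} {ι : A → L} {lt : FreeMagma A → FreeMagma A → Prop}

theorem IsHom.comp_basicFamily {M : Type*} [AddCommGroup M] [Module R M] [LieSuperalgebra R M]
    {φ : L →ₗ[R] M} (hφ : IsHom φ) :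
    φ ∘ basicFamily R p ι lt = basicFamily R p (fun a => φ (ι a)) lt := by
  ext (c | c)
  · exact hφ.map_eval ι c.1
  · change φ (bracket _ _) = bracket _ _
    rw [hφ.map_bracket, hφ.map_eval]

theorem top_le_span_basicFamily [LinearOrder A] (hlt : IsBasicOrder lt)
    (hι : ∀ a, ι a ∈ grade (R := R) (L := L) (p a))
    (hspan : Submodule.span R (Set.range (eval R ι)) = ⊤) :
    ⊤ ≤ Submodule.span R (Set.range (basicFamily R p ι lt)) := by
  rw [← hspan, Submodule.span_le]
  rintro _ ⟨t, rfl⟩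
  refine Submodule.span_mono ?_ (eval_mem_basicSpan hι hlt t)
  rintro _ (⟨c, hc, rfl⟩ | ⟨c, hc, hp, rfl⟩)
  · exact ⟨Sum.inl ⟨c, hc⟩, rfl⟩
  · exact ⟨Sum.inr ⟨c, hc, hp⟩, rfl⟩

end basicFamily

/-- In an associative superalgebra `[c, c]` is `2 c ^ 2` for odd `c`; so the squares stay independent
of the basic commutators if `2` is not a zero divisor. -/
theorem linearIndependent_basicFamily_ofGradedAlgebra {R T A : Type*} [CommRing R] [Ring T]
    [Algebra R T] (𝒜 : ZMod 2 → Submodule R T) [GradedAlgebra 𝒜] [LinearOrder A] {p : A → ZMod 2}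
    {x : A → T} {lt : FreeMagma A → FreeMagma A → Prop} (hlt : IsBasicOrder lt)
    (hx : ∀ a, x a ∈ 𝒜 (p a)) (hinj : Function.Injective (FreeAlgebra.lift R x))
    (h2 : ∀ r : R, 2 * r = 0 → r = 0) :
    letI := ofGradedAlgebra 𝒜
    LinearIndependent R (basicFamily R p x lt) := by
  classical
  let _ := ofGradedAlgebra 𝒜
  rw [linearIndependent_iff]
  intro l hl
  -- The coefficients of the elements `c` and of the associative squares `c ^ 2`.
  let α : ({c : FreeMagma A // IsBasicCommutator lt c} ⊕
      {c : FreeMagma A // IsBasicCommutator lt c ∧ c.parity p = 1} →₀ R) →ₗ[R]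
      (FreeMagma A →₀ R) :=
    Finsupp.linearCombination R (Sum.elim (fun c => Finsupp.single c.1 1) (fun _ => 0))
  let β : ({c : FreeMagma A // IsBasicCommutator lt c} ⊕
      {c : FreeMagma A // IsBasicCommutator lt c ∧ c.parity p = 1} →₀ R) →ₗ[R]
      (FreeMagma A →₀ R) :=
    Finsupp.linearCombination R (Sum.elim (fun _ => 0) (fun c => Finsupp.single c.1 2))
  have hαl : ∀ c l, α l c.1 = l (Sum.inl c) := fun c l => by
    have : Finsupp.lapply c.1 ∘ₗ α = Finsupp.lapply (Sum.inl c) := by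
      ext (d | d) <;> simp [α, Finsupp.single_apply, Subtype.ext_iff]
    exact LinearMap.congr_fun this l
  have hβl : ∀ c l, β l c.1 = 2 * l (Sum.inr c) := fun c l => by
    have : Finsupp.lapply c.1 ∘ₗ β = (2 : R) • Finsupp.lapply (Sum.inr c) := by
      ext (d | d) <;> simp [β, Finsupp.single_apply, Subtype.ext_iff]
    exact LinearMap.congr_fun this l
  have hbasic : ∀ c, ¬ IsBasicCommutator lt c → ∀ l, α l c = 0 ∧ β l c = 0 := fun c hc l => by
    have hne : ∀ d, IsBasicCommutator lt d → d ≠ c := fun d hd h => hc (h ▸ hd)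
    have h1 : Finsupp.lapply c ∘ₗ α = 0 := by
      ext (d | d)
      · simpa [α] using Finsupp.single_eq_of_ne' (hne d.1 d.2)
      · simp [α]
    have h2 : Finsupp.lapply c ∘ₗ β = 0 := by
      ext (d | d)
      · simp [β]
      · simpa [β] using Finsupp.single_eq_of_ne' (hne d.1 d.2.1)
    exact ⟨LinearMap.congr_fun h1 l, LinearMap.congr_fun h2 l⟩
  have hsum : Finsupp.linearCombination R (basicFamily R p x lt) =
      Finsupp.linearCombination R (superEval R p x) ∘ₗ α +
      Finsupp.linearCombination R (fun c => superEval R p x c * superEval R p x c) ∘ₗ β := by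
    ext (c | c)
    · simp [α, β, basicFamily, eval_ofGradedAlgebra 𝒜 hx]
    · have hg : superEval R p x c.1 ∈ 𝒜 1 := by
        have := eval_mem_grade (R := R) (p := p) (ι := x) hx c.1
        rw [c.2.2, eval_ofGradedAlgebra 𝒜 hx] at this
        exact this
      have := supercommutator_apply hg hg
      simp only [superSign_one_one, neg_smul, one_smul, sub_neg_eq_add] at this
      simp [α, β, basicFamily, eval_ofGradedAlgebra 𝒜 hx, two_smul]
      exact this
  have hzero := superEval_independent (p := p) hlt hinj ((α l).support ∪ (β l).support) (by
      intro c hc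
      by_contra h
      obtain ⟨h1, h2⟩ := hbasic c h l
      simp [h1, h2] at hc) (α l) (β l) (by
      rw [Finset.sum_add_distrib, ← hl, hsum, LinearMap.add_apply]
      congr 1
      · exact (Finsupp.linearCombination_apply_of_mem_supported R
          (by simp [Finsupp.mem_supported])).symm
      · exact (Finsupp.linearCombination_apply_of_mem_supported R
          (by simp [Finsupp.mem_supported])).symm)
  have hzero' : ∀ c, α l c = 0 ∧ β l c = 0 := fun c => by
    by_cases hc : c ∈ (α l).support ∪ (β l).support
    · exact hzero c hc
    · simpa using hc
  ext (c | c)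
  · rw [← hαl, (hzero' _).1, Finsupp.zero_apply]
  · exact h2 _ (by rw [← hβl, (hzero' _).2])

theorem linearIndependent_basicFamily_baseChange {R L A : Type*} (S : Type*) [CommRing R]
    [AddCommGroup L] [Module R L] [LieSuperalgebra R L] [CommRing S] [Algebra R S] [LinearOrder A]
    {p : A → ZMod 2} {ι : A → L} {lt : FreeMagma A → FreeMagma A → Prop} (hlt : IsBasicOrder lt)
    (hι : ∀ a, ι a ∈ grade (R := R) (L := L) (p a))
    (hspan : Submodule.span R (Set.range (eval R ι)) = ⊤)
    (hli : LinearIndependent R (basicFamily R p ι lt)) :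
    letI := baseChange (R := R) (L := L) S
    LinearIndependent S (basicFamily S p (fun a => TensorProduct.tmul R (1 : S) (ι a)) lt) := by
  let _ := baseChange (R := R) (L := L) S
  let b := Module.Basis.mk hli (top_le_span_basicFamily hlt hι hspan)
  convert (b.baseChange S).linearIndependent using 1
  ext (c | c)
  · simpa [b, basicFamily] using eval_baseChange S ι c.1
  · simp only [basicFamily, Sum.elim_inr, eval_baseChange, bracket_baseChange,
      Module.Basis.baseChange_apply, b, Module.Basis.mk_apply]

/-- The span of the products of homogeneous elements is a Lie superalgebra that is spanned by the
products of these elements taken inside it. -/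
theorem exists_spanned {R : Type*} {L : Type*} {A : Type*} [CommRing R] [AddCommGroup L]
    [Module R L] [LieSuperalgebra R L] {p : A → ZMod 2} {ι : A → L}
    (hι : ∀ a, ι a ∈ grade (R := R) (L := L) (p a)) :
    ∃ (_ : LieSuperalgebra R (Submodule.span R (Set.range (eval R ι))))
      (κ : A → Submodule.span R (Set.range (eval R ι))),
      IsHom (Submodule.span R (Set.range (eval R ι))).subtype ∧ (∀ a, (κ a : L) = ι a) ∧
      (∀ a, κ a ∈ grade (R := R) (L := Submodule.span R (Set.range (eval R ι))) (p a)) ∧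
      Submodule.span R (Set.range (eval R κ)) = ⊤ := by
  set K := Submodule.span R (Set.range (eval R ι)) with hK
  have hgr : ∀ x : K, ∃ y z, K.subtype y ∈ grade (R := R) (L := L) 0 ∧
      K.subtype z ∈ grade (R := R) (L := L) 1 ∧ x = y + z := fun x => by
    obtain ⟨y, hy, z, hz, hy', hz', h⟩ := exists_homogeneous_of_mem_span_eval hι x.2
    exact ⟨⟨y, hy⟩, ⟨z, hz⟩, hy', hz', Subtype.ext h⟩
  let i := ofInjective K.subtype K.injective_subtype
    (fun x y => ⟨_, bracket_mem_span_eval ι x.2 y.2⟩) (fun _ _ => rfl) hgr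
  have hom : IsHom K.subtype :=
    isHom_ofInjective K.subtype K.injective_subtype _ (fun _ _ => rfl) hgr
  let κ : A → K := fun a => ⟨ι a, Submodule.subset_span ⟨FreeMagma.of a, rfl⟩⟩
  refine ⟨i, κ, hom, fun a => rfl, hι, ?_⟩
  refine Submodule.map_injective_of_injective K.injective_subtype ?_
  rw [Submodule.map_span, ← Set.range_comp, Submodule.map_top, Submodule.range_subtype]
  refine Eq.trans ?_ hK.symm
  congr 2
  ext c
  exact hom.map_eval κ c

/-- The free monoid algebra, which carries the grading by parity, is free on its letters. -/
theorem freeAlgebra_lift_single_injective {R A B : Type*} [CommRing R] {f : A → B}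
    (hf : Function.Injective f) :
    Function.Injective (FreeAlgebra.lift R fun a =>
      (AddMonoidAlgebra.single (FreeAddMonoid.of (f a)) 1 : AddMonoidAlgebra R (FreeAddMonoid B))) := by
  classical
  let g : FreeAddMonoid B →+ Additive (FreeAlgebra R A) := FreeAddMonoid.lift fun b =>
    Additive.ofMul (if h : ∃ a, f a = b then FreeAlgebra.ι R h.choose else 0)
  let k : AddMonoidAlgebra R (FreeAddMonoid B) →ₐ[R] FreeAlgebra R A :=
    AddMonoidAlgebra.lift R _ _ (AddMonoidHom.toMultiplicativeLeft g)
  refine Function.LeftInverse.injective (g := k) fun u => ?_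
  have : k.comp (FreeAlgebra.lift R fun a =>
      (AddMonoidAlgebra.single (FreeAddMonoid.of (f a)) 1 : AddMonoidAlgebra R (FreeAddMonoid B))) =
      AlgHom.id R _ := by
    ext a
    have h : ∃ a', f a' = f a := ⟨a, rfl⟩
    have ha : h.choose = a := hf h.choose_spec
    simp [k, g, ha]
  exact AlgHom.congr_fun this u

/-- There is a Lie superalgebra over `R` in which the basic commutators and the squares of the odd
ones are linearly independent: extend scalars, from `ℤ` to `R`, in the Lie superalgebra that `A`
generates in the free associative algebra. -/
theorem exists_linearIndependent_basicFamily (R : Type u) [CommRing R] {A : Type v} [LinearOrder A]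
    (p : A → ZMod 2) {lt : FreeMagma A → FreeMagma A → Prop} (hlt : IsBasicOrder lt) :
    ∃ (M : Type (max u v w)) (_ : AddCommGroup M) (_ : Module R M) (_ : LieSuperalgebra R M)
      (f : A → M), (∀ a, f a ∈ grade (R := R) (L := M) (p a)) ∧
      LinearIndependent R (basicFamily R p f lt) := by
  -- The copy of `A` by `ULift` puts the result into the universe in which lifts exist.
  let T := AddMonoidAlgebra ℤ (FreeAddMonoid (ULift.{max u w} A))
  let deg : FreeAddMonoid (ULift.{max u w} A) →+ ZMod 2 := FreeAddMonoid.lift fun a => p a.down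
  let x : A → T := fun a => AddMonoidAlgebra.single (FreeAddMonoid.of ⟨a⟩) 1
  have hx : ∀ a, x a ∈ AddMonoidAlgebra.gradeBy ℤ deg (p a) := fun a => by
    have := AddMonoidAlgebra.single_mem_gradeBy deg (FreeAddMonoid.of ⟨a⟩) (1 : ℤ)
    simpa [deg] using this
  let iT : LieSuperalgebra ℤ T := ofGradedAlgebra (AddMonoidAlgebra.gradeBy ℤ deg)
  have hT : LinearIndependent ℤ (basicFamily ℤ p x lt) :=
    linearIndependent_basicFamily_ofGradedAlgebra _ hlt hx
      (freeAlgebra_lift_single_injective ULift.up_injective) (by simp)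
  obtain ⟨iK, κ, hom, hκ, hκg, hspan⟩ := exists_spanned (R := ℤ) (L := T) hx
  have hK : LinearIndependent ℤ (basicFamily ℤ p κ lt) := by
    refine LinearIndependent.of_comp (Submodule.subtype _) ?_
    rw [hom.comp_basicFamily]
    simpa [hκ] using hT
  exact ⟨_, _, _, baseChange (R := ℤ) R, _,
    fun a => Submodule.subset_span ⟨κ a, hκg a, rfl⟩,
    linearIndependent_basicFamily_baseChange R hlt hκg hspan hK⟩

end LieSuperalgebra

theorem theorem2 {R : Type*} [CommRing R] {A : Type*} [LinearOrder A] (p : A → ZMod 2)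
    {L : Type*} [AddCommGroup L] [Module R L] [LieSuperalgebra R L]
    (ι : A → L) (hι : LieSuperalgebra.IsFreeOn R p ι)
    (lt : FreeMagma A → FreeMagma A → Prop) (hlt : IsBasicOrder lt) :
    ∃ b : Module.Basis
        ({c : FreeMagma A // IsBasicCommutator lt c} ⊕
          {c : FreeMagma A // IsBasicCommutator lt c ∧
            LieSuperalgebra.eval R ι c ∈ LieSuperalgebra.grade (R := R) (L := L) 1}) R L,
      (∀ c, b (Sum.inl c) = LieSuperalgebra.eval R ι c.1) ∧
      (∀ c, b (Sum.inr c) = LieSuperalgebra.bracket (R := R)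
        (LieSuperalgebra.eval R ι c.1) (LieSuperalgebra.eval R ι c.1)) := by
  open LieSuperalgebra in
  have hspan := top_le_span_basicFamily hlt hι.mem_grade hι.span_eval_eq_top
  rcases subsingleton_or_nontrivial R with hR | hR
  · -- Over the zero ring every element is both even and odd, but everything is zero.
    have hL : Subsingleton L := Module.subsingleton R L
    refine ⟨Module.Basis.mk (v := Sum.elim (fun c => eval R ι c.1)
      (fun c => bracket (R := R) (eval R ι c.1) (eval R ι c.1)))
      (linearIndependent_iff.2 fun _ _ => Subsingleton.elim _ _) fun x _ => ?_,
      fun c => ?_, fun c => ?_⟩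
    · rw [Subsingleton.elim x 0]
      exact zero_mem _
    · simp
    · simp
  obtain ⟨M, _, _, _, f, hf, hli⟩ := exists_linearIndependent_basicFamily R p hlt
  obtain ⟨φ, ⟨hφ, hφf⟩, -⟩ := hι.existsUnique_lift M f hf
  have hliL : LinearIndependent R (basicFamily R p ι lt) := by
    refine LinearIndependent.of_comp φ ?_
    rw [hφ.comp_basicFamily]
    simpa only [hφf] using hli
  -- A basic commutator is nonzero, so the parity of its value is that of the formal product.
  have hodd : ∀ c, (IsBasicCommutator lt c ∧ c.parity p = 1) ↔
      (IsBasicCommutator lt c ∧ eval R ι c ∈ grade (R := R) (L := L) 1) := fun c => by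
    refine and_congr_right fun hc => ⟨fun h => h ▸ eval_mem_grade hι.mem_grade c, fun h => ?_⟩
    refine (c.parity p).eq_zero_or_eq_one_of_two.resolve_left fun h0 => ?_
    exact hliL.ne_zero (Sum.inl ⟨c, hc⟩) (Submodule.disjoint_def.1 isCompl_grade.disjoint _
      (h0 ▸ eval_mem_grade hι.mem_grade c) h)
  refine ⟨(Module.Basis.mk hliL hspan).reindex
    ((Equiv.refl _).sumCongr (Equiv.subtypeEquivRight hodd)), fun c => ?_, fun c => ?_⟩
  · simp [basicFamily]
  · simp [basicFamily]
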